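/- Let $\lambda\in\mathbb C$ with $\operatorname{Re}\lambda\ge 1$. For real $t,u$ define recursively $F_1(\lambda;t,u)=e^{itu}$ and, for $N\ge 2$ and $t,u\in\mathbb R^N$, $$F_N(\lambda;t,u)=\frac{e^{iu_N\sum_{j=1}^N t_j}}{(N-1)!}\int_{\mathbb R^{N-1}}\frac{\prod_{1\le j<k\le N-1}[4\sinh^2(s_j-s_k)]^{\lambda}}{\prod_{j=1}^{N}\prod_{k=1}^{N-1}[2\cosh(t_j-s_k)]^{\lambda}}\,F_{N-1}\big(\lambda;s,(u_1-u_N,\dots,u_{N-1}-u_N)\big)\,ds ,$$ where the powers of positive numbers are defined with real logarithms. For $N\ge1$ let $$\mathcal A_N=\{t\in\mathbb C^N:\ |\operatorname{Im}(t_j-t_k)|<\pi\ \text{ for all } 1\le j<k\le N\}.$$ Then, for $\operatorname{Re}\lambda\ge1$ and $u\in\mathbb R^N$, these integrals converge absolutely, and $F_N(\lambda;\cdot,u)$ extends (uniquely) from $\mathbb R^N$ to a holomorphic function on $\mathcal A_N$, again denoted by $F_N(\lambda;\cdot,u)$. For $t\in\mathbb C^N$ let $j_1,\dots,j_N$ be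 an enumeration of $1,\dots,N$ with $\operatorname{Im}t_{j_N}\le\dots\le\operatorname{Im}t_{j_1}$, and put $\phi_N(t)=\tfrac12\operatorname{Im}(t_{j_1}+t_{j_N})$ and $d_N(t)=\operatorname{Im}(t_{j_1}-t_{j_N})$. Theorem. For every $N\ge 1$ there is a continuous function $C$ on $\{\lambda\in\mathbb C:\operatorname{Re}\lambda\ge1\}\times[0,\pi)$ (depending only on $N$) such that for all $u\in\mathbb R^N$, all $\lambda\in\mathbb C$ with $\operatorname{Re}\lambda\ge 1$, all $t\in\mathcal A_N$ and every such enumeration, $$|F_N(\lambda;t,u)|<C(\lambda,d_N(t))\exp\Big(-\Big[\phi_N(t)\sum_{j=1}^N u_j+u_N\sum_{k=2}^{N-1}\big(\operatorname{Im}t_{j_k}-\phi_N(t)\big)\Big]\Big)\prod_{1\le m<n\le N}\frac{\operatorname{Re}(t_m-t_n)}{\sinh\big(\operatorname{Re}\lambda\,\operatorname{Re}(t_m-t_n)\big)},$$ where a factor with $\operatorname{Re}(t_m-t_n)=0$ is read as its limit $1/\operatorname{Re}\lambda$. -/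

import Mathlib

/-! Particle numbers are written `N = n + 1`, and indices `1, …, N` are the elements of
`Fin (n + 1)`; thus `0` is the first index and `Fin.last n` the last one. -/

namespace CalogeroMoser

noncomputable section

/-- The weight function `∏_{j<k} [4 sinh²(s_j - s_k)]^lam` at real points. -/
def weight (lam : ℂ) {m : ℕ} (s : Fin m → ℝ) : ℂ :=
  ∏ j : Fin m, ∏ k ∈ Finset.Ioi j, ((4 * Real.sinh (s j - s k) ^ 2 : ℝ) : ℂ) ^ lam

/-- The kernel function `∏_{j ≤ m+1} ∏_{k ≤ m} [2 cosh(t_j - s_k)]^{-lam}` at real points. -/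
def kernel (lam : ℂ) {m : ℕ} (t : Fin (m + 1) → ℝ) (s : Fin m → ℝ) : ℂ :=
  ∏ j : Fin (m + 1), ∏ k : Fin m, ((2 * Real.cosh (t j - s k) : ℝ) : ℂ) ^ (-lam)

/-- The shifted spectral vector `(u_1 - u_N, …, u_{N-1} - u_N)`. -/
def shift {n : ℕ} (u : Fin (n + 2) → ℝ) : Fin (n + 1) → ℝ :=
  fun j => u j.castSucc - u (Fin.last (n + 1))

/-- The function `F_{n+1}(lam; t, u)` for real `t`, given by the recursion
`F_1(t, u) = exp(i t u)` and
`F_N(t, u) = exp(i u_N ∑ t_j) / (N-1)! ∫_{ℝ^{N-1}} W(s) K(t, s) F_{N-1}(s, shift u) ds`. -/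
def realF (lam : ℂ) : (n : ℕ) → (Fin (n + 1) → ℝ) → (Fin (n + 1) → ℝ) → ℂ
  | 0, t, u => Complex.exp (Complex.I * (t 0 : ℂ) * (u 0 : ℂ))
  | n + 1, t, u =>
      Complex.exp (Complex.I * (u (Fin.last (n + 1)) : ℂ) * ∑ j, (t j : ℂ)) /
          (Nat.factorial (n + 1) : ℂ) *
        ∫ s : Fin (n + 1) → ℝ, weight lam s * kernel lam t s * realF lam n s (shift u)

/-- Absolute convergence of the integral that defines `F_{n+1}(lam; t, u)` at real `t`
(for one particle there is no integral). -/
def DefiningIntegralConverges (lam : ℂ) :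
    (n : ℕ) → (Fin (n + 1) → ℝ) → (Fin (n + 1) → ℝ) → Prop
  | 0, _, _ => True
  | n + 1, t, u =>
      MeasureTheory.Integrable
        (fun s : Fin (n + 1) → ℝ => weight lam s * kernel lam t s * realF lam n s (shift u))

/-- The domain `𝒜_{n+1}` of all `t ∈ ℂ^{n+1}` with `|Im (t_j - t_k)| < π` for all `j < k`. -/
def domainA (n : ℕ) : Set (Fin (n + 1) → ℂ) :=
  {t | ∀ j k, j < k → |(t j - t k).im| < Real.pi}

/-- `G` is holomorphic on `𝒜_{n+1}` and extends `F_{n+1}(lam; ·, u)` from the real points. Since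
`𝒜_{n+1}` is a convex open set that contains `ℝ^{n+1}`, the values of `G` on it are unique. -/
def IsContinuation (lam : ℂ) (n : ℕ) (u : Fin (n + 1) → ℝ) (G : (Fin (n + 1) → ℂ) → ℂ) : Prop :=
  DifferentiableOn ℂ G (domainA n) ∧
    ∀ x : Fin (n + 1) → ℝ, G (fun j => (x j : ℂ)) = realF lam n x u

open Classical in
/-- The function `F_{n+1}(lam; t, u)` for `t ∈ 𝒜_{n+1}`: the holomorphic continuation in `t` of the
recursively defined integral. -/
def F (lam : ℂ) (n : ℕ) (t : Fin (n + 1) → ℂ) (u : Fin (n + 1) → ℝ) : ℂ :=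
  if h : ∃ G, IsContinuation lam n u G then h.choose t else 0

/-- `j` is an enumeration `j_1, …, j_N` of the indices with
`Im t_{j_N} ≤ ⋯ ≤ Im t_{j_2} ≤ Im t_{j_1}`. -/
def IsImOrdering {n : ℕ} (t : Fin (n + 1) → ℂ) (j : Equiv.Perm (Fin (n + 1))) : Prop :=
  Antitone fun k => (t (j k)).im

/-- `φ_N(t) = Im (t_{j_1} + t_{j_N}) / 2`. -/
def phi {n : ℕ} (t : Fin (n + 1) → ℂ) (j : Equiv.Perm (Fin (n + 1))) : ℝ :=
  (t (j 0) + t (j (Fin.last n))).im / 2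

/-- `d_N(t) = Im (t_{j_1} - t_{j_N})`. -/
def dist {n : ℕ} (t : Fin (n + 1) → ℂ) (j : Equiv.Perm (Fin (n + 1))) : ℝ :=
  (t (j 0) - t (j (Fin.last n))).im

/-- The function `x / sinh (a x)`, with its continuous value `1 / a` at `x = 0`. -/
def sinhRatio (a x : ℝ) : ℝ :=
  if x = 0 then 1 / a else x / Real.sinh (a * x)

end

end CalogeroMoser

namespace CalogeroMoser

open MeasureTheory Real

noncomputable section

/-! ### Products over pairs -/

/-! The proof is an induction on the number of particles, and only the estimate at real points is
passed on. Write `a = Re lam`. If `F_{N-1}` at real `s` is at most a constant times the product of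
the `x / sinh (a x)` over the differences `x = s_k - s_l`, then multiplying by the weight leaves at
most `2|x| exp (a|x|)` per pair (`four_mul_sinh_sq_rpow_mul_sinhRatio_le`). For `|Im t_j| ≤ θ < π/2`
each kernel factor is at most a constant times `exp (-a |Re t_j - s_k|)`
(`norm_two_mul_cosh_cpow_le`). The integrand is thus dominated by the explicit function `model`.

The core is the integral of `model` (`exists_integral_model_le`). After sorting `t` and `s`,
`interlacing_inequality` extracts the decay `exp (-a |t_k - t_l|)` for all pairs and leaves decay in
the distance of `s_k` from `[t_{k+1}, t_k]`. The polynomial factors in `s` cost `1 + |t_k -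
t_{l+1}|` for `k < l`, and integrating over `s_k` costs `1 + |t_k - t_{k+1}|`. Together each pair of
the `t`'s is hit exactly once, which gives the product of `(1 + |x|) exp (-a |x|)` over the pairs,
comparable with that of `x / sinh (a x)`.

The integral is holomorphic in the tube `|Im t_j| < π/2`. Translating all `t_j` by `c` multiplies it
by `exp (i c ∑ u_j)` (`tubeF_add_const`), so it continues to every tube with a shifted axis, and
these tubes cover `domainA`. With the axis at `phi`, all imaginary parts lie within `d/2 < π/2` of
it. The factor `exp (-phi ∑ u_j)` comes from the shift, and the rest of the exponential from the
prefactor of the integral. -/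

theorem pairProd_comp_perm {m : ℕ} (f : ℝ → ℝ) (hf : ∀ x, 0 ≤ f x) (heven : ∀ x, f (-x) = f x)
    (x : Fin m → ℝ) (σ : Equiv.Perm (Fin m)) :
    ∏ k, ∏ l ∈ Finset.Ioi k, f (x (σ k) - x (σ l)) = ∏ k, ∏ l ∈ Finset.Ioi k, f (x k - x l) := by
  -- The square runs over all ordered pairs of distinct indices and is visibly permutation
  -- invariant; nonnegativity then permits taking roots.
  have sq : ∀ y : Fin m → ℝ, (∏ k, ∏ l ∈ Finset.Ioi k, f (y k - y l)) ^ 2 =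
      ∏ k, ∏ l, if l = k then 1 else f (y l - y k) := by
    intro y
    have h := Finset.prod_prod_Ioi_mul_eq_prod_prod_off_diag (fun j i : Fin m => f (y j - y i))
    rw [sq, ← Finset.prod_mul_distrib]
    simp_rw [← Finset.prod_mul_distrib]
    calc _ = ∏ i, ∏ j ∈ Finset.Ioi i, f (y j - y i) * f (y i - y j) := by
          refine Finset.prod_congr rfl fun i _ => Finset.prod_congr rfl fun j _ => ?_
          rw [← heven (y j - y i), neg_sub]
      _ = _ := by
          rw [h]
          refine Finset.prod_congr rfl fun i _ => ?_
          rw [Finset.prod_ite]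
          simp only [Finset.prod_const_one, one_mul]
          refine Finset.prod_congr ?_ fun _ _ => rfl
          ext j
          simp
  have hnn : ∀ y : Fin m → ℝ, 0 ≤ ∏ k, ∏ l ∈ Finset.Ioi k, f (y k - y l) := fun y =>
    Finset.prod_nonneg fun _ _ => Finset.prod_nonneg fun _ _ => hf _
  refine (sq_eq_sq₀ (hnn fun k => x (σ k)) (hnn x)).1 ?_
  rw [sq (fun k => x (σ k)), sq x,
    ← Equiv.prod_comp σ (fun k => ∏ l, if l = k then 1 else f (x l - x k))]
  refine Finset.prod_congr rfl fun k _ => ?_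
  rw [← Equiv.prod_comp σ (fun l => if l = σ k then 1 else f (x l - x (σ k)))]
  simp

/-- Neighbouring pairs come from the integrations over `s`, the others from the polynomial factors;
this puts the two families together. -/
theorem prod_Ioi_eq_prod_castSucc_succ {M : Type*} [CommMonoid M] {m : ℕ}
    (f : Fin (m + 1) → Fin (m + 1) → M) :
    ∏ k, ∏ l ∈ Finset.Ioi k, f k l =
      (∏ k : Fin m, f k.castSucc k.succ) *
        ∏ k : Fin m, ∏ l ∈ Finset.Ioi k, f k.castSucc l.succ := by
  induction m with
  | zero => simp
  | succ m ih =>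
    rw [Fin.prod_univ_succ, Fin.prod_Ioi_zero]
    simp_rw [Fin.prod_Ioi_succ]
    rw [ih fun k l => f k.succ l.succ, Fin.prod_univ_succ (fun k : Fin (m + 1) => f k.castSucc k.succ),
      Fin.prod_univ_succ (fun k : Fin (m + 1) => ∏ l ∈ Finset.Ioi k, f k.castSucc l.succ),
      Fin.prod_univ_succ (fun k : Fin (m + 1) => f 0 k.succ), Fin.prod_Ioi_zero]
    simp_rw [Fin.prod_Ioi_succ, Fin.castSucc_succ, Fin.castSucc_zero]
    rw [mul_mul_mul_comm]

/-! ### The interlacing inequality -/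

/-- When `s` interlaces the decreasing `t`, the right side is `∑ |t j - s k|`, so this is the case
of equality in `interlacing_inequality`. As a linear identity it needs no ordering. -/
theorem sum_sub_pairs_eq {m : ℕ} (t : Fin (m + 1) → ℝ) (s : Fin m → ℝ) :
    (∑ k, ∑ l ∈ Finset.Ioi k, (s k - s l)) + ∑ k, ∑ l ∈ Finset.Ioi k, (t k - t l) =
      ∑ j, ∑ k : Fin m, if j ≤ k.castSucc then t j - s k else s k - t j := by
  induction m with
  | zero => simp
  | succ m ih =>
    have h := ih (fun j => t j.succ) (fun k => s k.succ)
    rw [Fin.sum_univ_succ (fun k : Fin (m + 1) => ∑ l ∈ Finset.Ioi k, (s k - s l)),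
      Fin.sum_univ_succ (fun k : Fin (m + 2) => ∑ l ∈ Finset.Ioi k, (t k - t l)),
      Fin.sum_univ_succ (fun j : Fin (m + 2) => ∑ k : Fin (m + 1),
        if j ≤ k.castSucc then t j - s k else s k - t j)]
    simp only [Fin.sum_Ioi_zero, Fin.sum_Ioi_succ, Fin.zero_le, if_true]
    have h2 : ∀ j : Fin (m + 1), (∑ k : Fin (m + 1),
        if j.succ ≤ k.castSucc then t j.succ - s k else s k - t j.succ) =
        (s 0 - t j.succ) + ∑ k : Fin m, if j ≤ k.castSucc then t j.succ - s k.succ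
          else s k.succ - t j.succ := by
      intro j
      rw [Fin.sum_univ_succ]
      simp [Fin.castSucc_succ]
    simp_rw [h2]
    rw [Finset.sum_add_distrib, ← h, Fin.sum_univ_succ (fun k : Fin (m + 1) => t 0 - s k)]
    generalize ∑ k : Fin m, ∑ l ∈ Finset.Ioi k, (s k.succ - s l.succ) = S
    generalize ∑ k : Fin (m + 1), ∑ l ∈ Finset.Ioi k, (t k.succ - t l.succ) = T
    simp only [Finset.sum_sub_distrib, Finset.sum_const, Finset.card_univ, Fintype.card_fin,
      nsmul_eq_mul]
    push_cast
    ring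

/-- The distance from `x` to the interval `[b, a]`, when `b ≤ a`. -/
def gapDist (a b x : ℝ) : ℝ := max 0 (x - a) + max 0 (b - x)

theorem gapDist_nonneg (a b x : ℝ) : 0 ≤ gapDist a b x :=
  add_nonneg (le_max_left _ _) (le_max_left _ _)

/-- Each `|t j - s k|` is at least its signed version in `sum_sub_pairs_eq`. For the two neighbours
of `s k`, the excess `|y| - y = 2 max 0 (-y)` is kept, and these excesses add up to twice `gapDist`.
-/
theorem interlacing_inequality {m : ℕ} {t : Fin (m + 1) → ℝ} {s : Fin m → ℝ}
    (ht : Antitone t) (hs : Antitone s) :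
    (∑ k, ∑ l ∈ Finset.Ioi k, |s k - s l|) + (∑ k, ∑ l ∈ Finset.Ioi k, |t k - t l|) +
      2 * ∑ k : Fin m, gapDist (t k.castSucc) (t k.succ) (s k) ≤ ∑ j, ∑ k, |t j - s k| := by
  have h1 : ∑ k, ∑ l ∈ Finset.Ioi k, |s k - s l| = ∑ k, ∑ l ∈ Finset.Ioi k, (s k - s l) :=
    Finset.sum_congr rfl fun k _ => Finset.sum_congr rfl fun l hl =>
      abs_of_nonneg (sub_nonneg.2 (hs (Finset.mem_Ioi.1 hl).le))
  have h2 : ∑ k, ∑ l ∈ Finset.Ioi k, |t k - t l| = ∑ k, ∑ l ∈ Finset.Ioi k, (t k - t l) :=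
    Finset.sum_congr rfl fun k _ => Finset.sum_congr rfl fun l hl =>
      abs_of_nonneg (sub_nonneg.2 (ht (Finset.mem_Ioi.1 hl).le))
  have h3 : 2 * ∑ k : Fin m, gapDist (t k.castSucc) (t k.succ) (s k) =
      ∑ j : Fin (m + 1), ∑ k : Fin m, ((if j = k.castSucc then 2 * max 0 (s k - t j) else 0) +
        if j = k.succ then 2 * max 0 (t j - s k) else 0) := by
    rw [Finset.sum_comm, Finset.mul_sum]
    refine Finset.sum_congr rfl fun k _ => ?_
    rw [Finset.sum_add_distrib, Finset.sum_ite_eq' , Finset.sum_ite_eq', gapDist]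
    simp [mul_add]
  rw [h1, h2, h3, sum_sub_pairs_eq, ← Finset.sum_add_distrib]
  refine Finset.sum_le_sum fun j _ => ?_
  rw [← Finset.sum_add_distrib]
  refine Finset.sum_le_sum fun k _ => ?_
  by_cases hj : j ≤ k.castSucc
  · have hne : j ≠ k.succ := by
      rintro rfl
      simp [Fin.le_def] at hj
    rw [if_pos hj, if_neg hne]
    split_ifs
    · rcases le_total (t j) (s k) with h | h
      · rw [max_eq_right (by linarith), abs_of_nonpos (by linarith)]; linarith
      · rw [max_eq_left (by linarith), abs_of_nonneg (by linarith)]; linarith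
    · linarith [le_abs_self (t j - s k)]
  · have hne : j ≠ k.castSucc := by
      rintro rfl
      exact hj le_rfl
    rw [if_neg hj, if_neg hne]
    split_ifs
    · rcases le_total (t j) (s k) with h | h
      · rw [max_eq_left (by linarith), abs_of_nonpos (by linarith)]; linarith
      · rw [max_eq_right (by linarith), abs_of_nonneg (by linarith)]; linarith
    · linarith [neg_abs_le (t j - s k)]

/-! ### Integrals of exponentials of distances -/

theorem integrable_exp_neg_abs : Integrable fun x : ℝ => exp (-|x|) := by
  have h := integrable_of_isBigO_exp_neg (f := fun x : ℝ => exp (-|x|)) (a := 0) (b := 1) one_pos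
    (by fun_prop) (by
      refine Asymptotics.IsBigO.of_bound 1 ?_
      filter_upwards [Filter.eventually_ge_atTop 0] with x hx
      simp [abs_of_nonneg hx])
  have h2 : IntegrableOn (fun x : ℝ => exp (-|x|)) (Set.Iic 0) := by
    have := ((integrableOn_Ici_iff_integrableOn_Ioi (by simp)).2 h).comp_neg
    simpa using this
  have := h2.union h
  rwa [Set.Iic_union_Ioi, integrableOn_univ] at this

theorem exp_neg_gapDist_le {a b : ℝ} (x : ℝ) :
    exp (-gapDist a b x) ≤
      Set.indicator (Set.Icc b a) 1 x + (exp (-|x - a|) + exp (-|x - b|)) := by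
  have p1 := exp_pos (-|x - a|)
  have p2 := exp_pos (-|x - b|)
  by_cases hx : x ∈ Set.Icc b a
  · rw [Set.indicator_of_mem hx]
    have : exp (-gapDist a b x) ≤ 1 := exp_le_one_iff.2 (by linarith [gapDist_nonneg a b x])
    simp only [Pi.one_apply]
    linarith
  · rw [Set.indicator_of_notMem hx, zero_add]
    rw [Set.mem_Icc, not_and_or, not_le, not_le] at hx
    rcases hx with hx | hx
    · refine le_add_of_nonneg_of_le p1.le (exp_le_exp.2 ?_)
      rw [abs_of_neg (by linarith), gapDist]
      linarith [le_max_left 0 (x - a), le_max_right 0 (b - x)]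
    · refine le_add_of_le_of_nonneg (exp_le_exp.2 ?_) p2.le
      rw [abs_of_pos (by linarith), gapDist]
      linarith [le_max_right 0 (x - a), le_max_left 0 (b - x)]

theorem integrable_indicator_add_exp (a b : ℝ) : Integrable fun x : ℝ =>
    Set.indicator (Set.Icc b a) 1 x + (exp (-|x - a|) + exp (-|x - b|)) := by
  refine Integrable.add ?_ ((integrable_exp_neg_abs.comp_sub_right a).add
    (integrable_exp_neg_abs.comp_sub_right b))
  exact (integrable_indicator_iff measurableSet_Icc).2 (integrableOn_const (by simp))

theorem integrable_exp_neg_gapDist (a b : ℝ) : Integrable fun x => exp (-gapDist a b x) := by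
  refine (integrable_indicator_add_exp a b).mono' ?_ (ae_of_all _ fun x => ?_)
  · exact Continuous.aestronglyMeasurable (by unfold gapDist; fun_prop)
  · rw [norm_of_nonneg (exp_pos _).le]
    exact exp_neg_gapDist_le x

/-- The interval contributes its length and the two tails a constant. -/
theorem integral_exp_neg_gapDist_le {a b : ℝ} (h : b ≤ a) :
    ∫ x, exp (-gapDist a b x) ≤ (1 + 2 * ∫ x : ℝ, exp (-|x|)) * (1 + |a - b|) := by
  have h0 : 0 ≤ ∫ x : ℝ, exp (-|x|) := integral_nonneg fun x => (exp_pos _).le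
  have hi : Integrable (Set.indicator (Set.Icc b a) (1 : ℝ → ℝ)) :=
    (integrable_indicator_iff measurableSet_Icc).2 (integrableOn_const (by simp))
  calc ∫ x, exp (-gapDist a b x)
      ≤ ∫ x : ℝ, Set.indicator (Set.Icc b a) 1 x + (exp (-|x - a|) + exp (-|x - b|)) :=
        integral_mono (integrable_exp_neg_gapDist a b) (integrable_indicator_add_exp a b)
          exp_neg_gapDist_le
    _ = (a - b) + (2 * ∫ x : ℝ, exp (-|x|)) := by
        rw [integral_add hi (g := fun x => exp (-|x - a|) + exp (-|x - b|))
          ((integrable_exp_neg_abs.comp_sub_right a).add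
          (integrable_exp_neg_abs.comp_sub_right b)),
          integral_add (integrable_exp_neg_abs.comp_sub_right a)
          (integrable_exp_neg_abs.comp_sub_right b),
          integral_sub_right_eq_self (fun x : ℝ => exp (-|x|)) a,
          integral_sub_right_eq_self (fun x : ℝ => exp (-|x|)) b,
          integral_indicator_one measurableSet_Icc]
        simp [h, two_mul]
    _ ≤ _ := by
        rw [abs_of_nonneg (sub_nonneg.2 h)]
        nlinarith [mul_nonneg h0 (sub_nonneg.2 h)]

/-! ### The model integrand -/

/-- The real integrand that dominates the integrands of the recursion. -/
def model (a : ℝ) {m : ℕ} (t : Fin (m + 1) → ℝ) (s : Fin m → ℝ) : ℝ :=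
  (∏ k, ∏ l ∈ Finset.Ioi k, 2 * |s k - s l| * exp (a * |s k - s l|)) *
    ∏ j, ∏ k, exp (-(a * |t j - s k|))

theorem model_nonneg (a : ℝ) {m : ℕ} (t : Fin (m + 1) → ℝ) (s : Fin m → ℝ) : 0 ≤ model a t s :=
  mul_nonneg (Finset.prod_nonneg fun _ _ => Finset.prod_nonneg fun _ _ => by positivity)
    (Finset.prod_nonneg fun _ _ => Finset.prod_nonneg fun _ _ => by positivity)

theorem continuous_model (a : ℝ) {m : ℕ} (t : Fin (m + 1) → ℝ) :
    Continuous fun s : Fin m → ℝ => model a t s := by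
  unfold model
  fun_prop

theorem model_comp_perm_left (a : ℝ) {m : ℕ} (t : Fin (m + 1) → ℝ) (s : Fin m → ℝ)
    (σ : Equiv.Perm (Fin (m + 1))) : model a (t ∘ σ) s = model a t s := by
  unfold model
  rw [← Equiv.prod_comp σ fun j => ∏ k, exp (-(a * |t j - s k|))]
  rfl

theorem model_comp_perm_right (a : ℝ) {m : ℕ} (t : Fin (m + 1) → ℝ) (s : Fin m → ℝ)
    (σ : Equiv.Perm (Fin m)) : model a t (s ∘ σ) = model a t s := by
  unfold model
  congr 1
  · exact pairProd_comp_perm (fun x => 2 * |x| * exp (a * |x|)) (fun x => by positivity)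
      (fun x => by simp) s σ
  · refine Finset.prod_congr rfl fun j _ => ?_
    exact Equiv.prod_comp σ fun k => exp (-(a * |t j - s k|))

/-- Since `s k` exceeds `t k.castSucc` by at most its gap distance, and `s l` falls below `t l.succ`
by at most its own, `s k - s l` is at most `t k.castSucc - t l.succ` plus the two gaps. This choice
of endpoints leaves the neighbouring pairs of `t` unused. -/
theorem two_mul_abs_sub_le {m : ℕ} {t : Fin (m + 1) → ℝ} {s : Fin m → ℝ}
    (ht : Antitone t) (hs : Antitone s) {k l : Fin m} (hkl : k < l) :
    2 * |s k - s l| ≤ (1 + |t k.castSucc - t l.succ|) *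
      (2 * (1 + ∑ k : Fin m, gapDist (t k.castSucc) (t k.succ) (s k))) := by
  set δ : Fin m → ℝ := fun k => gapDist (t k.castSucc) (t k.succ) (s k) with hδ
  have hδ0 : ∀ i, 0 ≤ δ i := fun i => gapDist_nonneg _ _ _
  have hsum : δ k + δ l ≤ ∑ i, δ i := by
    rw [← Finset.sum_pair hkl.ne]
    exact Finset.sum_le_sum_of_subset_of_nonneg (Finset.subset_univ _) fun i _ _ => hδ0 i
  have h1 : s k - t k.castSucc ≤ δ k := by
    simp only [hδ, gapDist]
    linarith [le_max_right 0 (s k - t k.castSucc), le_max_left 0 (t k.succ - s k)]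
  have h2 : t l.succ - s l ≤ δ l := by
    simp only [hδ, gapDist]
    linarith [le_max_left 0 (s l - t l.castSucc), le_max_right 0 (t l.succ - s l)]
  have h3 : 0 ≤ s k - s l := sub_nonneg.2 (hs hkl.le)
  have h4 : 0 ≤ t k.castSucc - t l.succ := by
    refine sub_nonneg.2 (ht ?_)
    rw [Fin.le_def, Fin.val_castSucc, Fin.val_succ]
    have := Fin.lt_def.1 hkl
    omega
  rw [abs_of_nonneg h3, abs_of_nonneg h4]
  have := add_nonneg (hδ0 k) (hδ0 l)
  nlinarith [mul_nonneg h4 (this.trans hsum)]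

theorem one_add_pow_le_exp (M : ℕ) {x : ℝ} (hx : 0 ≤ x) :
    (1 + x) ^ M ≤ M.factorial * exp 1 * exp x := by
  have h := pow_div_factorial_le_exp (1 + x) (by linarith) M
  rw [div_le_iff₀ (by positivity), exp_add] at h
  linarith

theorem exists_model_le_of_antitone (m : ℕ) : ∃ c : ℝ, 0 < c ∧ ∀ a : ℝ, 1 ≤ a →
    ∀ (t : Fin (m + 1) → ℝ) (s : Fin m → ℝ), Antitone t → Antitone s →
      model a t s ≤ c * (∏ k : Fin m, ∏ l ∈ Finset.Ioi k, (1 + |t k.castSucc - t l.succ|)) *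
        (∏ k, ∏ l ∈ Finset.Ioi k, exp (-(a * |t k - t l|))) *
        ∏ k : Fin m, exp (-gapDist (t k.castSucc) (t k.succ) (s k)) := by
  set P : ℕ := ∑ k : Fin m, (Finset.Ioi k).card with hP
  refine ⟨2 ^ P * (P.factorial * exp 1), by positivity, fun a ha t s ht hs => ?_⟩
  set Δ : ℝ := ∑ k : Fin m, gapDist (t k.castSucc) (t k.succ) (s k) with hΔ
  have hΔ0 : 0 ≤ Δ := Finset.sum_nonneg fun _ _ => gapDist_nonneg _ _ _
  set Q : ℝ := ∏ k : Fin m, ∏ l ∈ Finset.Ioi k, (1 + |t k.castSucc - t l.succ|) with hQ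
  have hQ0 : 0 ≤ Q := Finset.prod_nonneg fun _ _ => Finset.prod_nonneg fun _ _ => by positivity
  have hpoly : ∏ k, ∏ l ∈ Finset.Ioi k, 2 * |s k - s l| ≤ Q * (2 * (1 + Δ)) ^ P := by
    calc ∏ k, ∏ l ∈ Finset.Ioi k, 2 * |s k - s l|
        ≤ ∏ k : Fin m, ∏ l ∈ Finset.Ioi k, (1 + |t k.castSucc - t l.succ|) * (2 * (1 + Δ)) := by
          refine Finset.prod_le_prod
            (fun _ _ => Finset.prod_nonneg fun _ _ => by positivity) fun k _ => ?_
          exact Finset.prod_le_prod (fun _ _ => by positivity) fun l hl =>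
            two_mul_abs_sub_le ht hs (Finset.mem_Ioi.1 hl)
      _ = _ := by
          simp_rw [Finset.prod_mul_distrib, Finset.prod_const]
          rw [Finset.prod_pow_eq_pow_sum, Finset.prod_pow_eq_pow_sum, mul_pow]
  have hinter := interlacing_inequality ht hs
  rw [← hΔ] at hinter
  unfold model
  simp_rw [Finset.prod_mul_distrib (f := fun l => 2 * |s _ - s l|)]
  rw [Finset.prod_mul_distrib]
  simp_rw [← exp_sum]
  simp_rw [Finset.sum_neg_distrib, ← Finset.mul_sum]
  rw [← hΔ]
  set X := ∑ k, ∑ l ∈ Finset.Ioi k, |s k - s l|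
  set Y := ∑ k, ∑ l ∈ Finset.Ioi k, |t k - t l|
  set Z := ∑ j, ∑ k, |t j - s k|
  -- By interlacing and `1 ≤ a` there are two factors `exp (-Δ)`: one absorbs the polynomial in `Δ`,
  -- the other is kept for integrability. The constant is thereby independent of `a`.
  have hexp : exp (a * X) * exp (-(a * Z)) ≤ exp (-(a * Y)) * exp (-Δ) * exp (-Δ) := by
    rw [← exp_add, ← exp_add, ← exp_add, exp_le_exp]
    nlinarith
  have hpow : (2 * (1 + Δ)) ^ P ≤ 2 ^ P * (P.factorial * exp 1) * exp Δ := by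
    rw [mul_pow, mul_assoc]
    exact mul_le_mul_of_nonneg_left (one_add_pow_le_exp P hΔ0) (by positivity)
  calc (∏ k, ∏ l ∈ Finset.Ioi k, 2 * |s k - s l|) * exp (a * X) * exp (-(a * Z))
      = (∏ k, ∏ l ∈ Finset.Ioi k, 2 * |s k - s l|) * (exp (a * X) * exp (-(a * Z))) := by ring
    _ ≤ (Q * (2 ^ P * (P.factorial * exp 1) * exp Δ)) *
          (exp (-(a * Y)) * exp (-Δ) * exp (-Δ)) := by
        refine mul_le_mul (hpoly.trans (mul_le_mul_of_nonneg_left hpow hQ0)) hexp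
          (by positivity) (by positivity)
    _ = 2 ^ P * (P.factorial * exp 1) * Q * exp (-(a * Y)) * exp (-Δ) * (exp Δ * exp (-Δ)) := by
        ring
    _ = _ := by rw [← exp_add, add_neg_cancel, exp_zero, mul_one]

theorem exists_perm_antitone {m : ℕ} (x : Fin m → ℝ) : ∃ σ : Equiv.Perm (Fin m), Antitone (x ∘ σ) :=
  ⟨Tuple.sort fun k => -x k, fun _ _ h => neg_le_neg_iff.1 (Tuple.monotone_sort (fun k => -x k) h)⟩

theorem integrable_prod_comp_perm {m : ℕ} {f : Fin m → ℝ → ℝ} (hf : ∀ k, Integrable (f k))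
    (σ : Equiv.Perm (Fin m)) : Integrable fun s : Fin m → ℝ => ∏ k, f k (s (σ k)) := by
  have : (fun s : Fin m → ℝ => ∏ k, f k (s (σ k))) = fun s => ∏ k, f (σ.symm k) (s k) := by
    ext s
    rw [← Equiv.prod_comp σ fun k => f (σ.symm k) (s k)]
    simp
  rw [this]
  exact Integrable.fintype_prod fun k => hf _

theorem integral_prod_comp_perm {m : ℕ} (f : Fin m → ℝ → ℝ) (σ : Equiv.Perm (Fin m)) :
    ∫ s : Fin m → ℝ, ∏ k, f k (s (σ k)) = ∏ k, ∫ x, f k x := by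
  have : (fun s : Fin m → ℝ => ∏ k, f k (s (σ k))) = fun s => ∏ k, f (σ.symm k) (s k) := by
    ext s
    rw [← Equiv.prod_comp σ fun k => f (σ.symm k) (s k)]
    simp
  rw [this, integral_fintype_prod_volume_eq_prod fun k => f (σ.symm k)]
  exact Equiv.prod_comp σ.symm fun k => ∫ x, f k x

/-- The function `(1 + |x|) exp (-a |x|)`, comparable with `x / sinh (a x)`. -/
def pairDecay (a x : ℝ) : ℝ := (1 + |x|) * exp (-(a * |x|))

theorem pairDecay_pos (a x : ℝ) : 0 < pairDecay a x := by
  unfold pairDecay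
  positivity

theorem exists_integral_model_le (m : ℕ) : ∃ c : ℝ, 0 < c ∧ ∀ a : ℝ, 1 ≤ a →
    ∀ t : Fin (m + 1) → ℝ, Integrable (fun s : Fin m → ℝ => model a t s) ∧
      ∫ s : Fin m → ℝ, model a t s ≤ c * ∏ k, ∏ l ∈ Finset.Ioi k, pairDecay a (t k - t l) := by
  obtain ⟨c, hc, hle⟩ := exists_model_le_of_antitone m
  set e : ℝ := 1 + 2 * ∫ x : ℝ, exp (-|x|) with he
  have he0 : 0 < e := by
    have h0 : 0 ≤ ∫ x : ℝ, exp (-|x|) := integral_nonneg fun x => (exp_pos _).le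
    linarith
  refine ⟨Fintype.card (Equiv.Perm (Fin m)) * (c * e ^ m), by positivity, fun a ha t => ?_⟩
  wlog ht : Antitone t generalizing t
  · obtain ⟨τ, hτ⟩ := exists_perm_antitone t
    obtain ⟨h1, h2⟩ := this (t ∘ τ) hτ
    simp only [model_comp_perm_left] at h1 h2
    refine ⟨h1, h2.trans_eq ?_⟩
    congr 1
    exact pairProd_comp_perm (pairDecay a) (fun x => (pairDecay_pos a x).le)
      (fun x => by simp [pairDecay]) t τ
  set f : Fin m → ℝ → ℝ := fun k x => exp (-gapDist (t k.castSucc) (t k.succ) x) with hf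
  have hfi : ∀ k, Integrable (f k) := fun k => integrable_exp_neg_gapDist _ _
  set K : ℝ := c * (∏ k : Fin m, ∏ l ∈ Finset.Ioi k, (1 + |t k.castSucc - t l.succ|)) *
        (∏ k, ∏ l ∈ Finset.Ioi k, exp (-(a * |t k - t l|))) with hK
  have hK0 : 0 ≤ K := by
    refine mul_nonneg (mul_nonneg hc.le ?_) ?_ <;>
    exact Finset.prod_nonneg fun _ _ => Finset.prod_nonneg fun _ _ => by positivity
  -- The permutation that sorts `s` depends on `s`; summing the sorted bound over all permutations
  -- removes this dependence, and each summand is a product of functions of one variable.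
  have hbound : ∀ s : Fin m → ℝ, model a t s ≤
      ∑ σ : Equiv.Perm (Fin m), K * ∏ k, f k (s (σ k)) := by
    intro s
    obtain ⟨σ, hσ⟩ := exists_perm_antitone s
    rw [← model_comp_perm_right a t s σ]
    refine (hle a ha t (s ∘ σ) ht hσ).trans ?_
    exact Finset.single_le_sum (f := fun σ : Equiv.Perm (Fin m) => K * ∏ k, f k (s (σ k)))
      (fun σ _ => mul_nonneg hK0 (Finset.prod_nonneg fun _ _ => (exp_pos _).le))
      (Finset.mem_univ σ)
  have hint : Integrable fun s : Fin m → ℝ =>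
      ∑ σ : Equiv.Perm (Fin m), K * ∏ k, f k (s (σ k)) :=
    integrable_finsetSum _ fun σ _ => (integrable_prod_comp_perm hfi σ).const_mul K
  have hmodel : Integrable (fun s : Fin m → ℝ => model a t s) :=
    hint.mono' (continuous_model a t).aestronglyMeasurable (ae_of_all _ fun s => by
      rw [norm_of_nonneg (model_nonneg a t s)]
      exact hbound s)
  refine ⟨hmodel, (integral_mono hmodel hint hbound).trans ?_⟩
  rw [integral_finsetSum _ fun σ _ => (integrable_prod_comp_perm hfi σ).const_mul K]
  simp_rw [integral_const_mul, integral_prod_comp_perm]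
  rw [Finset.sum_const, Finset.card_univ, nsmul_eq_mul,
    mul_assoc (Fintype.card (Equiv.Perm (Fin m)) : ℝ)]
  refine mul_le_mul_of_nonneg_left ?_ (Nat.cast_nonneg _)
  have hprod : ∏ k, ∫ x, f k x ≤ e ^ m * ∏ k : Fin m, (1 + |t k.castSucc - t k.succ|) := by
    calc ∏ k, ∫ x, f k x ≤ ∏ k : Fin m, e * (1 + |t k.castSucc - t k.succ|) :=
          Finset.prod_le_prod (fun k _ => integral_nonneg fun x => (exp_pos _).le)
            fun k _ => integral_exp_neg_gapDist_le (ht k.castSucc_lt_succ.le)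
      _ = _ := by simp [Finset.prod_mul_distrib]
  refine (mul_le_mul_of_nonneg_left hprod hK0).trans_eq ?_
  simp only [pairDecay, Finset.prod_mul_distrib]
  rw [prod_Ioi_eq_prod_castSucc_succ fun k l => 1 + |t k - t l|, hK]
  ring

/-! ### Comparison of hyperbolic functions with exponentials -/

theorem sinhRatio_neg (a x : ℝ) : sinhRatio a (-x) = sinhRatio a x := by
  simp [sinhRatio, neg_div_neg_eq]

theorem sinhRatio_pos {a : ℝ} (ha : 0 < a) (x : ℝ) : 0 < sinhRatio a x := by
  wlog hx : 0 ≤ x generalizing x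
  · rw [← sinhRatio_neg]
    exact this _ (by linarith)
  unfold sinhRatio
  split_ifs with h
  · positivity
  · have hx' : 0 < x := lt_of_le_of_ne hx (Ne.symm h)
    exact div_pos hx' (sinh_pos_iff.2 (mul_pos ha hx'))

/-- For `x > 0` the claim is `(1 + x)(1 - exp (-2ax))/2 ≤ (a + 1) x`. The summand `1` uses `1 - exp
(-2ax) ≤ 2ax`, the summand `x` uses `1 - exp (-2ax) ≤ 1`. -/
theorem pairDecay_le_sinhRatio {a : ℝ} (ha : 0 < a) (x : ℝ) :
    pairDecay a x ≤ (a + 1) * sinhRatio a x := by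
  wlog hx : 0 ≤ x generalizing x
  · rw [← sinhRatio_neg]
    refine le_trans (le_of_eq ?_) (this (-x) (by linarith))
    simp [pairDecay]
  rw [pairDecay, abs_of_nonneg hx]
  unfold sinhRatio
  split_ifs with h
  · subst h
    have : (1 : ℝ) ≤ (a + 1) * (1 / a) := by
      rw [mul_one_div, le_div_iff₀ ha]
      linarith
    simpa using this
  · have hx' : 0 < x := lt_of_le_of_ne hx (Ne.symm h)
    have hy : 0 < a * x := mul_pos ha hx'
    rw [mul_div_assoc', le_div_iff₀ (sinh_pos_iff.2 hy), sinh_eq]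
    have e1 : exp (-(a * x)) * exp (a * x) = 1 := by rw [← exp_add]; simp
    have e2 : 1 - 2 * (a * x) ≤ exp (-(a * x)) * exp (-(a * x)) := by
      rw [← exp_add]
      linarith [add_one_le_exp (-(a * x) + -(a * x))]
    have e3 : 0 ≤ exp (-(a * x)) * exp (-(a * x)) := by positivity
    have : (1 + x) * exp (-(a * x)) * ((exp (a * x) - exp (-(a * x))) / 2) =
      (1 + x) * (1 - exp (-(a * x)) * exp (-(a * x))) / 2 := by
      rw [← e1]; ring
    rw [this]
    nlinarith

/-- Superadditivity of `y ↦ y ^ a` for `a ≥ 1`, applied to `2 sinh x + exp (-x) = exp x` with `x ≥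
0`. -/
theorem two_mul_abs_sinh_rpow_le {a : ℝ} (ha : 1 ≤ a) (x : ℝ) :
    (2 * |sinh x|) ^ a ≤ 2 * |sinh (a * x)| := by
  wlog hx : 0 ≤ x generalizing x
  · have := this (-x) (by linarith)
    simpa using this
  have h1 : 0 ≤ sinh x := sinh_nonneg_iff.2 hx
  have h2 : 0 ≤ sinh (a * x) := sinh_nonneg_iff.2 (by positivity)
  rw [abs_of_nonneg h1, abs_of_nonneg h2]
  have h := NNReal.add_rpow_le_rpow_add (⟨2 * sinh x, by positivity⟩ : NNReal)
    ⟨exp (-x), (exp_pos _).le⟩ ha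
  have h' : (2 * sinh x) ^ a + exp (-x) ^ a ≤ (2 * sinh x + exp (-x)) ^ a := by exact_mod_cast h
  have h3 : 2 * sinh x + exp (-x) = exp x := by rw [sinh_eq]; ring
  rw [h3, ← exp_mul, ← exp_mul] at h'
  rw [sinh_eq (a * x)]
  have h4 : -(a * x) = -x * a := by ring
  rw [h4, mul_comm a x]
  linarith

/-- Of the two factors `(2|sinh x|) ^ a`, one cancels `sinh (a x)` in the denominator and the other
is at most `exp (a|x|)`. -/
theorem four_mul_sinh_sq_rpow_mul_sinhRatio_le {a : ℝ} (ha : 1 ≤ a) (x : ℝ) :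
    (4 * sinh x ^ 2) ^ a * sinhRatio a x ≤ 2 * |x| * exp (a * |x|) := by
  have ha0 : 0 < a := by linarith
  by_cases hx : x = 0
  · subst hx
    simp [zero_rpow ha0.ne']
  have hs : sinh (a * x) ≠ 0 := by
    rw [Ne, sinh_eq_zero]
    exact mul_ne_zero ha0.ne' hx
  have h1 : sinhRatio a x = |x| / |sinh (a * x)| := by
    rw [← abs_div, ← abs_of_pos (sinhRatio_pos ha0 x), sinhRatio, if_neg hx]
  have h2 : (4 * sinh x ^ 2) ^ a = (2 * |sinh x|) ^ a * (2 * |sinh x|) ^ a := by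
    rw [← mul_rpow (by positivity) (by positivity)]
    congr 1
    rw [← sq_abs]; ring
  have h3 : (2 * |sinh x|) ^ a ≤ exp (a * |x|) := by
    rw [mul_comm a, exp_mul]
    refine rpow_le_rpow (by positivity) ?_ ha0.le
    rw [abs_sinh, sinh_eq]
    linarith [exp_pos (-|x|)]
  rw [h1, h2]
  have hp : 0 < |sinh (a * x)| := abs_pos.2 hs
  rw [mul_div_assoc', div_le_iff₀ hp]
  calc (2 * |sinh x|) ^ a * (2 * |sinh x|) ^ a * |x|
      ≤ exp (a * |x|) * (2 * |sinh (a * x)|) * |x| :=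
        mul_le_mul_of_nonneg_right
          (mul_le_mul h3 (two_mul_abs_sinh_rpow_le ha x) (by positivity) (by positivity))
          (abs_nonneg x)
    _ = _ := by ring

/-! ### Complex analysis -/

theorem eqOn_of_eq_ofReal {U : Set ℂ} (hU : IsOpen U) (hconv : Convex ℝ U)
    (hreal : ∀ x : ℝ, (x : ℂ) ∈ U) {f g : ℂ → ℂ} (hf : DifferentiableOn ℂ f U)
    (hg : DifferentiableOn ℂ g U) (h : ∀ x : ℝ, f x = g x) : Set.EqOn f g U := by
  refine (hf.analyticOnNhd hU).eqOn_of_preconnected_of_frequently_eq (hg.analyticOnNhd hU)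
    hconv.isPreconnected (by simpa using hreal 0) (z₀ := 0) ?_
  have ht : Filter.Tendsto (fun x : ℝ => (x : ℂ)) (nhdsWithin 0 {0}ᶜ) (nhdsWithin 0 {0}ᶜ) := by
    refine tendsto_nhdsWithin_iff.2 ⟨?_, ?_⟩
    · exact (Complex.continuous_ofReal.tendsto' 0 0 (by simp)).mono_left nhdsWithin_le_nhds
    · filter_upwards [self_mem_nhdsWithin] with x hx
      simpa using hx
  exact ht.frequently (Filter.Eventually.frequently (Filter.Eventually.of_forall h))

/-- Directional derivatives are limits of measurable difference quotients, and finitely many of them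
determine the derivative. The index is offset by `K` so that every quotient uses points where
measurability is known. -/
theorem aestronglyMeasurable_fderiv {α : Type*} [MeasurableSpace α] {μ : Measure α} {n : ℕ}
    {f : (Fin n → ℂ) → α → ℂ} {x : Fin n → ℂ}
    (hmeas : ∀ᶠ t in nhds x, AEStronglyMeasurable (f t) μ)
    (hdiff : ∀ s, DifferentiableAt ℂ (fun t => f t s) x) :
    AEStronglyMeasurable (fun s => fderiv ℂ (fun t => f t s) x) μ := by
  have hv : ∀ v : Fin n → ℂ, AEStronglyMeasurable (fun s => fderiv ℂ (fun t => f t s) x v) μ := by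
    intro v
    have hε : Filter.Tendsto (fun k : ℕ => ((1 / ((k : ℝ) + 1) : ℝ) : ℂ)) Filter.atTop
        (nhdsWithin 0 {0}ᶜ) := by
      refine tendsto_nhdsWithin_iff.2 ⟨?_, Filter.Eventually.of_forall fun k => ?_⟩
      · have := (Complex.continuous_ofReal.tendsto 0).comp tendsto_one_div_add_atTop_nhds_zero_nat
        simpa only [Function.comp_def, Complex.ofReal_zero] using this
      · have : (0 : ℝ) < 1 / ((k : ℝ) + 1) := by positivity
        simp only [Set.mem_compl_iff, Set.mem_singleton_iff, Complex.ofReal_eq_zero]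
        exact this.ne'
    have hx : Filter.Tendsto (fun k : ℕ => x + ((1 / ((k : ℝ) + 1) : ℝ) : ℂ) • v) Filter.atTop
        (nhds x) := by
      have h1 := (tendsto_nhdsWithin_iff.1 hε).1.smul_const v
      simpa using h1.const_add x
    obtain ⟨K, hK⟩ := Filter.eventually_atTop.1 (hx.eventually hmeas)
    have hx0 := hmeas.self_of_nhds
    refine aestronglyMeasurable_of_tendsto_ae Filter.atTop
      (f := fun (k : ℕ) s => ((1 / (((k + K : ℕ) : ℝ) + 1) : ℝ) : ℂ)⁻¹ •
        (f (x + ((1 / (((k + K : ℕ) : ℝ) + 1) : ℝ) : ℂ) • v) s - f x s))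
      (fun k => ((hK (k + K) (Nat.le_add_left _ _)).sub hx0).fun_const_smul _)
      (ae_of_all _ fun s => ?_)
    have hl := ((hdiff s).hasFDerivAt.hasLineDerivAt v).tendsto_slope_zero
    exact (hl.comp hε).comp (Filter.tendsto_add_atTop_nat K)
  have : (fun s => fderiv ℂ (fun t => f t s) x) = fun s =>
      ∑ i, fderiv ℂ (fun t => f t s) x (Pi.single i 1) •
        (ContinuousLinearMap.proj i : (Fin n → ℂ) →L[ℂ] ℂ) := by
    ext s w
    conv_lhs => rw [← Finset.univ_sum_single w]
    simp only [sum_apply, smul_apply,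
      ContinuousLinearMap.proj_apply, map_sum]
    refine Finset.sum_congr rfl fun i _ => ?_
    have : (Pi.single i (w i) : Fin n → ℂ) = w i • Pi.single i 1 := by
      rw [← Pi.single_smul]; simp
    rw [this, map_smul, smul_eq_mul, smul_eq_mul, mul_comm]
  rw [this]
  exact Finset.aestronglyMeasurable_fun_sum _ fun i _ => (hv _).smul_const _

/-- A locally dominated integral of holomorphic functions is holomorphic. -/
theorem differentiableOn_integral_of_locally_dominated {α : Type*} [MeasurableSpace α]
    {μ : Measure α} {n : ℕ} {f : (Fin n → ℂ) → α → ℂ} {U : Set (Fin n → ℂ)} (hU : IsOpen U)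
    (hmeas : ∀ t ∈ U, AEStronglyMeasurable (f t) μ)
    (hdiff : ∀ s, DifferentiableOn ℂ (fun t => f t s) U)
    (hdom : ∀ x ∈ U, ∃ b : α → ℝ, Integrable b μ ∧ ∀ᶠ t in nhds x, ∀ s, ‖f t s‖ ≤ b s) :
    DifferentiableOn ℂ (fun t => ∫ s, f t s ∂μ) U := by
  intro x hx
  obtain ⟨b, hb, hle⟩ := hdom x hx
  have hUx : ∀ᶠ t in nhds x, t ∈ U := hU.mem_nhds hx
  obtain ⟨r, hr, hball⟩ := Metric.eventually_nhds_iff_ball.1 (hle.and hUx)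
  have hr2 : 0 < r / 2 := by positivity
  have hd : ∀ s, ∀ t ∈ U, DifferentiableAt ℂ (fun t => f t s) t := fun s t ht =>
    (hdiff s).differentiableAt (hU.mem_nhds ht)
  have hmeas' : ∀ᶠ t in nhds x, AEStronglyMeasurable (f t) μ := hUx.mono hmeas
  -- The bound on the derivative is a Cauchy estimate: on a ball of radius `r / 2` about `t`, the
  -- values stay within `2 * b s` of `f t s`.
  have key := hasFDerivAt_integral_of_dominated_of_fderiv_le (μ := μ) (𝕜 := ℂ)
    (F := f) (F' := fun t s => fderiv ℂ (fun t => f t s) t) (x₀ := x)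
    (bound := fun s => 2 * b s / (r / 2)) (Metric.ball_mem_nhds x hr2) hmeas'
    (hb.mono' (hmeas x hx) (ae_of_all _ fun s => (hball x (Metric.mem_ball_self hr)).1 s))
    (aestronglyMeasurable_fderiv hmeas' fun s => hd s x hx)
    (ae_of_all _ fun s t ht => ?_) ((hb.const_mul 2).div_const _)
    (ae_of_all _ fun s t ht => (hd s t (hball t (Metric.ball_subset_ball (by linarith) ht)).2).hasFDerivAt)
  · exact key.differentiableAt.differentiableWithinAt
  · have hsub : Metric.ball t (r / 2) ⊆ Metric.ball x r := fun y hy => by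
      have := dist_triangle y t x
      rw [Metric.mem_ball] at *
      linarith
    refine Complex.norm_fderiv_le_div_of_mapsTo_ball
      ((hdiff s).mono fun y hy => (hball y (hsub hy)).2) (fun y hy => ?_) hr2
    rw [Metric.mem_closedBall, dist_eq_norm]
    have h1 := (hball y (hsub hy)).1 s
    have h2 := (hball t (hsub (Metric.mem_ball_self hr2))).1 s
    linarith [norm_sub_le (f y s) (f t s)]

/-! ### Bounds for powers of the hyperbolic cosine -/

theorem re_two_mul_cosh (z : ℂ) : (2 * Complex.cosh z).re = 2 * (cosh z.re * cos z.im) := by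
  have h : Complex.cosh z = Complex.cosh (z.re + z.im * Complex.I) := by rw [Complex.re_add_im]
  rw [h, Complex.cosh_add, Complex.cosh_mul_I, Complex.sinh_mul_I, ← Complex.ofReal_cosh,
    ← Complex.ofReal_sinh, ← Complex.ofReal_cos, ← Complex.ofReal_sin]
  simp [-Complex.ofReal_cos, -Complex.ofReal_cosh]

theorem two_mul_cosh_mem_slitPlane {z : ℂ} (hz : |z.im| < π / 2) :
    2 * Complex.cosh z ∈ Complex.slitPlane := by
  refine Or.inl ?_
  rw [re_two_mul_cosh]
  have := cos_pos_of_mem_Ioo (abs_lt.1 hz)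
  have := cosh_pos z.re
  positivity

/-- The constant that bounds one factor of the kernel in a closed strip. -/
def coshConst (lam : ℂ) (θ : ℝ) : ℝ := cos θ ^ (-lam.re) * exp (π * |lam.im|)

theorem coshConst_pos (lam : ℂ) {θ : ℝ} (h0 : 0 ≤ θ) (hθ : θ < π / 2) : 0 < coshConst lam θ := by
  have := cos_pos_of_mem_Ioo (x := θ) ⟨by linarith, hθ⟩
  unfold coshConst
  positivity

/-- The modulus of `2 cosh z` is at least its real part `2 cosh (Re z) cos (Im z) ≥ cos θ exp |Re
z|`. The imaginary part of `lam` acts only through the argument, which is at most `π` in absolute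
value. -/
theorem norm_two_mul_cosh_cpow_le {lam : ℂ} (hlam : 0 ≤ lam.re) {θ : ℝ} (hθ : θ < π / 2) {z : ℂ}
    (hz : |z.im| ≤ θ) :
    ‖(2 * Complex.cosh z) ^ (-lam)‖ ≤ coshConst lam θ * exp (-(lam.re * |z.re|)) := by
  have hθ0 : 0 ≤ θ := (abs_nonneg _).trans hz
  have hcos : 0 < cos θ := cos_pos_of_mem_Ioo ⟨by linarith, hθ⟩
  have hcos' : cos θ ≤ cos z.im := by
    rw [← cos_abs z.im]
    exact cos_le_cos_of_nonneg_of_le_pi (abs_nonneg _) (by linarith) hz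
  have hlow : cos θ * exp |z.re| ≤ ‖2 * Complex.cosh z‖ := by
    refine le_trans ?_ (Complex.re_le_norm _)
    rw [re_two_mul_cosh]
    have h1 : exp |z.re| ≤ 2 * cosh z.re := by
      rw [← cosh_abs, cosh_eq]
      linarith [exp_pos (-|z.re|)]
    nlinarith [exp_pos |z.re|]
  refine (Complex.norm_cpow_le _ _).trans ?_
  rw [div_eq_mul_inv, ← exp_neg, Complex.neg_re, Complex.neg_im]
  have e1 : ‖2 * Complex.cosh z‖ ^ (-lam.re) ≤ cos θ ^ (-lam.re) * exp (-(lam.re * |z.re|)) := by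
    refine (rpow_le_rpow_of_nonpos (by positivity) hlow (by linarith)).trans_eq ?_
    rw [mul_rpow hcos.le (exp_pos _).le, ← exp_mul]
    congr 2
    ring
  have e2 : exp (-((2 * Complex.cosh z).arg * -lam.im)) ≤ exp (π * |lam.im|) := by
    rw [exp_le_exp]
    have h1 := Complex.abs_arg_le_pi (2 * Complex.cosh z)
    calc -((2 * Complex.cosh z).arg * -lam.im) = (2 * Complex.cosh z).arg * lam.im := by ring
      _ ≤ |(2 * Complex.cosh z).arg * lam.im| := le_abs_self _
      _ ≤ π * |lam.im| := by
        rw [abs_mul]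
        exact mul_le_mul_of_nonneg_right h1 (abs_nonneg _)
  calc _ ≤ cos θ ^ (-lam.re) * exp (-(lam.re * |z.re|)) * exp (π * |lam.im|) :=
        mul_le_mul e1 e2 (exp_pos _).le (by positivity)
    _ = _ := by rw [coshConst]; ring

/-! ### The kernel at complex points -/

/-- The kernel function at complex first argument. -/
def complexKernel (lam : ℂ) {m : ℕ} (t : Fin (m + 1) → ℂ) (s : Fin m → ℝ) : ℂ :=
  ∏ j : Fin (m + 1), ∏ k : Fin m, (2 * Complex.cosh (t j - s k)) ^ (-lam)

theorem complexKernel_ofReal (lam : ℂ) {m : ℕ} (t : Fin (m + 1) → ℝ) (s : Fin m → ℝ) :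
    complexKernel lam (fun j => (t j : ℂ)) s = kernel lam t s := by
  simp [complexKernel, kernel]

/-- The tube of all `t` with `|Im t_j| < π / 2`. -/
def tube (m : ℕ) : Set (Fin m → ℂ) := {t | ∀ j, |(t j).im| < π / 2}

theorem isOpen_tube (m : ℕ) : IsOpen (tube m) := by
  simp only [tube, Set.ofPred_forall]
  exact isOpen_iInter_of_finite fun j => isOpen_lt (by fun_prop) continuous_const

theorem differentiableOn_finsetProd {E ι : Type*} [NormedAddCommGroup E] [NormedSpace ℂ E]
    {U : Set E} {f : ι → E → ℂ} (S : Finset ι) (h : ∀ i ∈ S, DifferentiableOn ℂ (f i) U) :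
    DifferentiableOn ℂ (fun t => ∏ i ∈ S, f i t) U := by
  classical
  exact fun t ht =>
    (HasFDerivWithinAt.finsetProd fun i hi => (h i hi t ht).hasFDerivWithinAt).differentiableWithinAt

theorem differentiableOn_complexKernel (lam : ℂ) {m : ℕ} (s : Fin m → ℝ) :
    DifferentiableOn ℂ (fun t => complexKernel lam t s) (tube (m + 1)) := by
  unfold complexKernel
  refine differentiableOn_finsetProd _ fun j _ => differentiableOn_finsetProd _ fun k _ => ?_
  refine DifferentiableOn.cpow_const (fun t ht => ?_) fun t ht => ?_
  · apply DifferentiableAt.differentiableWithinAt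
    fun_prop
  · refine two_mul_cosh_mem_slitPlane ?_
    simpa using ht j

theorem measurable_complexKernel (lam : ℂ) {m : ℕ} (t : Fin (m + 1) → ℂ) :
    Measurable fun s : Fin m → ℝ => complexKernel lam t s := by
  unfold complexKernel
  fun_prop

theorem measurable_weight (lam : ℂ) {m : ℕ} : Measurable fun s : Fin m → ℝ => weight lam s := by
  unfold weight
  fun_prop

theorem norm_complexKernel_le {lam : ℂ} (hlam : 0 ≤ lam.re) {θ : ℝ} (hθ : θ < π / 2) {m : ℕ}
    {t : Fin (m + 1) → ℂ} (ht : ∀ j, |(t j).im| ≤ θ) (s : Fin m → ℝ) :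
    ‖complexKernel lam t s‖ ≤ coshConst lam θ ^ ((m + 1) * m) *
      ∏ j, ∏ k, exp (-(lam.re * |(t j).re - s k|)) := by
  unfold complexKernel
  simp_rw [norm_prod]
  calc _ ≤ ∏ j : Fin (m + 1), ∏ k : Fin m,
        coshConst lam θ * exp (-(lam.re * |(t j).re - s k|)) := by
        refine Finset.prod_le_prod (fun _ _ => Finset.prod_nonneg fun _ _ => norm_nonneg _)
          fun j _ => Finset.prod_le_prod (fun _ _ => norm_nonneg _) fun k _ => ?_
        have := norm_two_mul_cosh_cpow_le hlam hθ (z := t j - s k) (by simpa using ht j)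
        simpa using this
    _ = _ := by
        simp [Finset.prod_mul_distrib, ← pow_mul, mul_comm]

theorem norm_weight {lam : ℂ} (hlam : 0 < lam.re) {m : ℕ} (s : Fin m → ℝ) :
    ‖weight lam s‖ = ∏ j : Fin m, ∏ k ∈ Finset.Ioi j, (4 * sinh (s j - s k) ^ 2) ^ lam.re := by
  unfold weight
  simp_rw [norm_prod]
  refine Finset.prod_congr rfl fun j _ => Finset.prod_congr rfl fun k _ => ?_
  exact Complex.norm_cpow_eq_rpow_re_of_nonneg (by positivity) hlam.ne'

theorem weight_add_const (lam : ℂ) {m : ℕ} (s : Fin m → ℝ) (c : ℝ) :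
    weight lam (fun k => s k + c) = weight lam s := by
  simp [weight]

theorem complexKernel_add_const (lam : ℂ) {m : ℕ} (t : Fin (m + 1) → ℂ) (s : Fin m → ℝ) (c : ℝ) :
    complexKernel lam (fun j => t j + c) (fun k => s k + c) = complexKernel lam t s := by
  simp [complexKernel]

/-! ### The recursion integral in the tube -/

/-- Makes the domination locally uniform in `t`: moving each coordinate by at most one costs at most
`exp a` in each factor. -/
theorem model_le_of_abs_sub_le_one {a : ℝ} (ha : 0 ≤ a) {m : ℕ} {x y : Fin (m + 1) → ℝ}
    (h : ∀ j, |x j - y j| ≤ 1) (s : Fin m → ℝ) :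
    model a x s ≤ exp a ^ ((m + 1) * m) * model a y s := by
  have : ∏ j, ∏ k, exp (-(a * |x j - s k|)) ≤
      exp a ^ ((m + 1) * m) * ∏ j, ∏ k, exp (-(a * |y j - s k|)) := by
    calc _ ≤ ∏ j : Fin (m + 1), ∏ k : Fin m, exp a * exp (-(a * |y j - s k|)) := by
          refine Finset.prod_le_prod (fun _ _ => Finset.prod_nonneg fun _ _ => (exp_pos _).le)
            fun j _ => Finset.prod_le_prod (fun _ _ => (exp_pos _).le) fun k _ => ?_
          rw [← exp_add, exp_le_exp]
          have h1 : |y j - s k| ≤ 1 + |x j - s k| := by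
            have := abs_sub_le (y j) (x j) (s k)
            rw [abs_sub_comm (y j) (x j)] at this
            linarith [h j]
          nlinarith
      _ = _ := by simp [Finset.prod_mul_distrib, ← pow_mul, mul_comm]
  unfold model
  calc _ ≤ (∏ k, ∏ l ∈ Finset.Ioi k, 2 * |s k - s l| * exp (a * |s k - s l|)) *
        (exp a ^ ((m + 1) * m) * ∏ j, ∏ k, exp (-(a * |y j - s k|))) :=
        mul_le_mul_of_nonneg_left this
          (Finset.prod_nonneg fun _ _ => Finset.prod_nonneg fun _ _ => by positivity)
    _ = _ := by ring

/-- `realF lam n` is continuous in its first argument and bounded by `B` times the product of the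
functions `x / sinh (Re lam x)`. -/
def RealBound (lam : ℂ) (n : ℕ) (B : ℝ) : Prop :=
  ∀ u : Fin (n + 1) → ℝ, (Continuous fun s => realF lam n s u) ∧
    ∀ s, ‖realF lam n s u‖ ≤ B * ∏ k, ∏ l ∈ Finset.Ioi k, sinhRatio lam.re (s k - s l)

/-- The integrand of the recursion at complex points. -/
def integrand (lam : ℂ) (n : ℕ) (u : Fin (n + 2) → ℝ) (t : Fin (n + 2) → ℂ)
    (s : Fin (n + 1) → ℝ) : ℂ :=
  weight lam s * complexKernel lam t s * realF lam n s (shift u)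

theorem aestronglyMeasurable_integrand {lam : ℂ} {n : ℕ} {B : ℝ} (hB : RealBound lam n B)
    (u : Fin (n + 2) → ℝ) (t : Fin (n + 2) → ℂ) :
    AEStronglyMeasurable (integrand lam n u t) :=
  (((measurable_weight lam).mul (measurable_complexKernel lam t)).mul
    (hB (shift u)).1.measurable).aestronglyMeasurable

theorem norm_integrand_le {lam : ℂ} (hlam : 1 ≤ lam.re) {n : ℕ} {B : ℝ} (hB0 : 0 ≤ B)
    (hB : RealBound lam n B) (u : Fin (n + 2) → ℝ) {θ : ℝ} (hθ : θ < π / 2) {t : Fin (n + 2) → ℂ}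
    (ht : ∀ j, |(t j).im| ≤ θ) (s : Fin (n + 1) → ℝ) :
    ‖integrand lam n u t s‖ ≤
      B * coshConst lam θ ^ ((n + 2) * (n + 1)) * model lam.re (fun j => (t j).re) s := by
  have hlam0 : 0 < lam.re := by linarith
  have h1 := norm_complexKernel_le hlam0.le hθ ht s
  have h2 : ‖weight lam s‖ * ‖realF lam n s (shift u)‖ ≤
      B * ∏ k, ∏ l ∈ Finset.Ioi k, 2 * |s k - s l| * exp (lam.re * |s k - s l|) := by
    calc ‖weight lam s‖ * ‖realF lam n s (shift u)‖
        ≤ ‖weight lam s‖ * (B * ∏ k, ∏ l ∈ Finset.Ioi k, sinhRatio lam.re (s k - s l)) :=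
          mul_le_mul_of_nonneg_left ((hB (shift u)).2 s) (norm_nonneg _)
      _ = B * ∏ k, ∏ l ∈ Finset.Ioi k,
            ((4 * sinh (s k - s l) ^ 2) ^ lam.re * sinhRatio lam.re (s k - s l)) := by
          rw [norm_weight hlam0]
          simp_rw [Finset.prod_mul_distrib]
          ring
      _ ≤ _ := by
          refine mul_le_mul_of_nonneg_left ?_ hB0
          have hnn : ∀ x : ℝ, 0 ≤ (4 * sinh x ^ 2) ^ lam.re * sinhRatio lam.re x := fun x =>
            mul_nonneg (by positivity) (sinhRatio_pos hlam0 x).le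
          exact Finset.prod_le_prod (fun _ _ => Finset.prod_nonneg fun _ _ => hnn _)
            fun k _ => Finset.prod_le_prod (fun _ _ => hnn _)
              fun l _ => four_mul_sinh_sq_rpow_mul_sinhRatio_le hlam _
  unfold integrand
  rw [norm_mul, norm_mul]
  calc _ = ‖weight lam s‖ * ‖realF lam n s (shift u)‖ * ‖complexKernel lam t s‖ := by ring
    _ ≤ _ := mul_le_mul h2 h1 (norm_nonneg _) (mul_nonneg hB0
          (Finset.prod_nonneg fun _ _ => Finset.prod_nonneg fun _ _ => by positivity))
    _ = _ := by rw [model]; ring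

theorem integrable_integrand {lam : ℂ} (hlam : 1 ≤ lam.re) {n : ℕ} {B : ℝ} (hB0 : 0 ≤ B)
    (hB : RealBound lam n B) (u : Fin (n + 2) → ℝ) {θ : ℝ} (hθ : θ < π / 2) {t : Fin (n + 2) → ℂ}
    (ht : ∀ j, |(t j).im| ≤ θ) : Integrable (integrand lam n u t) := by
  obtain ⟨c, -, hc⟩ := exists_integral_model_le (n + 1)
  exact ((hc lam.re hlam fun j => (t j).re).1.const_mul _).mono'
    (aestronglyMeasurable_integrand hB u t)
    (ae_of_all _ fun s => norm_integrand_le hlam hB0 hB u hθ ht s)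

/-- The strict inequality lets the same `θ` serve for all nearby points. -/
theorem exists_abs_im_lt {m : ℕ} {t : Fin (m + 1) → ℂ} (ht : t ∈ tube (m + 1)) :
    ∃ θ < π / 2, ∀ j, |(t j).im| < θ := by
  obtain ⟨i, -, hi⟩ := Finset.exists_max_image Finset.univ (fun j => |(t j).im|)
    Finset.univ_nonempty
  have := ht i
  exact ⟨(|(t i).im| + π / 2) / 2, by linarith, fun j => by
    linarith [hi j (Finset.mem_univ j)]⟩

/-- The function `F_{n+2}` in the tube, where no shift of the contour is necessary. -/
def tubeF (lam : ℂ) (n : ℕ) (u : Fin (n + 2) → ℝ) (t : Fin (n + 2) → ℂ) : ℂ :=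
  Complex.exp (Complex.I * (u (Fin.last (n + 1)) : ℂ) * ∑ j, t j) / (Nat.factorial (n + 1) : ℂ) *
    ∫ s : Fin (n + 1) → ℝ, integrand lam n u t s

theorem tubeF_ofReal (lam : ℂ) (n : ℕ) (u x : Fin (n + 2) → ℝ) :
    tubeF lam n u (fun j => (x j : ℂ)) = realF lam (n + 1) x u := by
  simp [tubeF, realF, integrand, complexKernel_ofReal]

theorem differentiableOn_tubeF {lam : ℂ} (hlam : 1 ≤ lam.re) {n : ℕ} {B : ℝ} (hB0 : 0 ≤ B)
    (hB : RealBound lam n B) (u : Fin (n + 2) → ℝ) :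
    DifferentiableOn ℂ (tubeF lam n u) (tube (n + 2)) := by
  unfold tubeF
  refine DifferentiableOn.mul (fun t _ => DifferentiableAt.differentiableWithinAt (by fun_prop)) ?_
  refine differentiableOn_integral_of_locally_dominated (isOpen_tube _)
    (fun t _ => aestronglyMeasurable_integrand hB u t) (fun s => ?_) fun x hx => ?_
  · unfold integrand
    exact ((differentiableOn_complexKernel lam s).const_mul _).mul_const _
  · obtain ⟨θ, hθ, hxθ⟩ := exists_abs_im_lt hx
    obtain ⟨c, -, hc⟩ := exists_integral_model_le (n + 1)
    refine ⟨fun s => B * coshConst lam θ ^ ((n + 2) * (n + 1)) *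
      (exp lam.re ^ ((n + 2) * (n + 1)) * model lam.re (fun j => (x j).re) s),
      ((hc lam.re hlam fun j => (x j).re).1.const_mul _).const_mul _, ?_⟩
    have hθ0 : 0 ≤ θ := (abs_nonneg _).trans (hxθ 0).le
    have e1 : ∀ᶠ t in nhds x, ∀ j, |(t j).im| < θ := by
      refine Filter.eventually_all.2 fun j => ?_
      exact ContinuousAt.eventually_lt (f := fun t : Fin (n + 2) → ℂ => |(t j).im|)
        (Complex.continuous_im.comp (continuous_apply j)).abs.continuousAt continuousAt_const
        (hxθ j)
    filter_upwards [e1, Metric.ball_mem_nhds x one_pos] with t ht hball s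
    refine (norm_integrand_le hlam hB0 hB u hθ (fun j => (ht j).le) s).trans ?_
    refine mul_le_mul_of_nonneg_left ?_
      (mul_nonneg hB0 (pow_nonneg (coshConst_pos lam hθ0 hθ).le _))
    refine model_le_of_abs_sub_le_one (by linarith) (fun j => ?_) s
    rw [← Complex.sub_re]
    refine (Complex.abs_re_le_norm _).trans ?_
    rw [← Pi.sub_apply]
    refine (norm_le_pi_norm _ j).trans ?_
    rw [← dist_eq_norm]
    exact (Metric.mem_ball.1 hball).le

/-- Here `c` and `P` depend on `n` alone and `lam`, `θ` enter explicitly, so that continuity of the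
final constant can be read off. -/
theorem exists_norm_tubeF_le (n : ℕ) : ∃ (c : ℝ) (P : ℕ), 0 < c ∧ ∀ lam : ℂ, 1 ≤ lam.re →
    ∀ B : ℝ, 0 ≤ B → RealBound lam n B → ∀ (u : Fin (n + 2) → ℝ) (θ : ℝ), θ < π / 2 →
      ∀ t : Fin (n + 2) → ℂ, (∀ j, |(t j).im| ≤ θ) →
        ‖tubeF lam n u t‖ ≤ exp (-(u (Fin.last (n + 1)) * ∑ j, (t j).im)) *
          (B * coshConst lam θ ^ ((n + 2) * (n + 1)) * (c * (lam.re + 1) ^ P) *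
            ∏ k, ∏ l ∈ Finset.Ioi k, sinhRatio lam.re (t k - t l).re) := by
  obtain ⟨c, hc0, hc⟩ := exists_integral_model_le (n + 1)
  refine ⟨c, ∑ k : Fin (n + 2), (Finset.Ioi k).card, hc0, ?_⟩
  intro lam hlam B hB0 hB u θ hθ t ht
  have hlam0 : 0 < lam.re := by linarith
  have hθ0 : 0 ≤ θ := (abs_nonneg _).trans (ht 0)
  set D := B * coshConst lam θ ^ ((n + 2) * (n + 1)) with hD
  have hD0 : 0 ≤ D := mul_nonneg hB0 (pow_nonneg (coshConst_pos lam hθ0 hθ).le _)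
  obtain ⟨hmi, hm⟩ := hc lam.re hlam fun j => (t j).re
  have hdecay : ∏ k, ∏ l ∈ Finset.Ioi k, pairDecay lam.re ((t k).re - (t l).re) ≤
      (lam.re + 1) ^ (∑ k : Fin (n + 2), (Finset.Ioi k).card) *
        ∏ k, ∏ l ∈ Finset.Ioi k, sinhRatio lam.re (t k - t l).re := by
    calc _ ≤ ∏ k, ∏ l ∈ Finset.Ioi k, (lam.re + 1) * sinhRatio lam.re (t k - t l).re :=
          Finset.prod_le_prod
            (fun _ _ => Finset.prod_nonneg fun _ _ => (pairDecay_pos _ _).le)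
            fun k _ => Finset.prod_le_prod (fun _ _ => (pairDecay_pos _ _).le)
              fun l _ => pairDecay_le_sinhRatio hlam0 _
      _ = _ := by
          simp_rw [Finset.prod_mul_distrib, Finset.prod_const]
          rw [Finset.prod_pow_eq_pow_sum]
  have hint : ‖∫ s : Fin (n + 1) → ℝ, integrand lam n u t s‖ ≤
      D * (c * (lam.re + 1) ^ (∑ k : Fin (n + 2), (Finset.Ioi k).card)) *
        ∏ k, ∏ l ∈ Finset.Ioi k, sinhRatio lam.re (t k - t l).re := by
    calc _ ≤ ∫ s : Fin (n + 1) → ℝ, D * model lam.re (fun j => (t j).re) s :=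
          norm_integral_le_of_norm_le (hmi.const_mul D)
            (ae_of_all _ fun s => norm_integrand_le hlam hB0 hB u hθ ht s)
      _ ≤ D * (c * ((lam.re + 1) ^ (∑ k : Fin (n + 2), (Finset.Ioi k).card) *
        ∏ k, ∏ l ∈ Finset.Ioi k, sinhRatio lam.re (t k - t l).re)) := by
          rw [integral_const_mul]
          exact mul_le_mul_of_nonneg_left
            (hm.trans (mul_le_mul_of_nonneg_left hdecay hc0.le)) hD0
      _ = _ := by ring
  have hexp : ‖Complex.exp (Complex.I * (u (Fin.last (n + 1)) : ℂ) * ∑ j, t j) /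
      (Nat.factorial (n + 1) : ℂ)‖ ≤ exp (-(u (Fin.last (n + 1)) * ∑ j, (t j).im)) := by
    rw [norm_div, Complex.norm_exp, Complex.norm_natCast]
    refine (div_le_self (exp_pos _).le ?_).trans_eq ?_
    · exact_mod_cast Nat.factorial_pos (n + 1)
    · congr 1
      rw [mul_assoc, Complex.I_mul_re, Complex.im_ofReal_mul, Complex.im_sum]
  unfold tubeF
  rw [norm_mul]
  exact mul_le_mul hexp hint (norm_nonneg _) (exp_pos _).le

/-! ### Translations -/

theorem sum_shift {n : ℕ} (u : Fin (n + 2) → ℝ) :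
    ∑ j, shift u j = ∑ j, u j - (n + 2) * u (Fin.last (n + 1)) := by
  rw [Fin.sum_univ_castSucc u]
  simp only [shift, Finset.sum_sub_distrib, Finset.sum_const, Finset.card_univ, Fintype.card_fin,
    nsmul_eq_mul]
  push_cast
  ring

/-- Substitute `s + c` for `s`: weight and kernel depend on differences only. The inner function
yields `∑ shift u`, and the prefactor restores the missing multiple of the last `u`. The hypothesis
is the induction hypothesis of `realF_add_const`. -/
theorem tubeF_add_ofReal_of_realF_add {lam : ℂ} {n : ℕ}
    (h : ∀ (u s : Fin (n + 1) → ℝ) (c : ℝ), realF lam n (fun k => s k + c) u =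
      Complex.exp (Complex.I * c * (∑ j, u j : ℝ)) * realF lam n s u)
    (u : Fin (n + 2) → ℝ) (t : Fin (n + 2) → ℂ) (c : ℝ) :
    tubeF lam n u (fun j => t j + c) =
      Complex.exp (Complex.I * c * (∑ j, u j : ℝ)) * tubeF lam n u t := by
  have hint : ∫ s : Fin (n + 1) → ℝ, integrand lam n u (fun j => t j + c) s =
      Complex.exp (Complex.I * c * (∑ j, shift u j : ℝ)) *
        ∫ s : Fin (n + 1) → ℝ, integrand lam n u t s := by
    rw [← integral_add_right_eq_self (integrand lam n u fun j => t j + c)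
      (fun _ : Fin (n + 1) => c), ← integral_const_mul]
    refine integral_congr_ae (ae_of_all _ fun s => ?_)
    have hs : s + (fun _ : Fin (n + 1) => c) = fun k => s k + c := rfl
    simp only [hs, integrand, weight_add_const, complexKernel_add_const, h]
    ring
  unfold tubeF
  rw [hint, sum_shift]
  have hsum : ∑ j, (t j + c) = (∑ j, t j) + (n + 2) * c := by
    simp [Finset.sum_add_distrib]
  rw [hsum]
  have he : Complex.exp (Complex.I * (u (Fin.last (n + 1)) : ℂ) * ((∑ j, t j) + (n + 2) * c)) *
      Complex.exp (Complex.I * c * (∑ j, u j - (n + 2) * u (Fin.last (n + 1)) : ℝ)) =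
      Complex.exp (Complex.I * c * (∑ j, u j : ℝ)) *
        Complex.exp (Complex.I * (u (Fin.last (n + 1)) : ℂ) * ∑ j, t j) := by
    rw [← Complex.exp_add, ← Complex.exp_add]
    congr 1
    push_cast
    ring
  rw [div_mul_eq_mul_div, div_mul_eq_mul_div, mul_div_assoc', ← mul_assoc, he]
  ring

theorem realF_add_const (lam : ℂ) (n : ℕ) (u s : Fin (n + 1) → ℝ) (c : ℝ) :
    realF lam n (fun k => s k + c) u =
      Complex.exp (Complex.I * c * (∑ j, u j : ℝ)) * realF lam n s u := by
  induction n generalizing c with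
  | zero =>
    simp only [realF, ← Complex.exp_add]
    congr 1
    simp
    ring
  | succ n ih =>
    rw [← tubeF_ofReal, ← tubeF_ofReal, ← tubeF_add_ofReal_of_realF_add ih]
    simp

/-- Both sides are holomorphic in `c` on the convex set of admissible translations, which contains
the real axis, where they agree. -/
theorem tubeF_add_const {lam : ℂ} (hlam : 1 ≤ lam.re) {n : ℕ} {B : ℝ} (hB0 : 0 ≤ B)
    (hB : RealBound lam n B) (u : Fin (n + 2) → ℝ) {t : Fin (n + 2) → ℂ} {c : ℂ}
    (ht : t ∈ tube (n + 2)) (htc : (fun j => t j + c) ∈ tube (n + 2)) :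
    tubeF lam n u (fun j => t j + c) =
      Complex.exp (Complex.I * c * (∑ j, u j : ℝ)) * tubeF lam n u t := by
  set U : Set ℂ := {c | (fun j => t j + c) ∈ tube (n + 2)} with hU
  have hUo : IsOpen U :=
    (isOpen_tube (n + 2)).preimage (f := fun c : ℂ => fun j => t j + c) (by fun_prop)
  have hUc : Convex ℝ U := by
    intro x hx y hy a b ha hb hab j
    have := (convex_ball (0 : ℝ) (π / 2)) (mem_ball_zero_iff.2 (hx j)) (mem_ball_zero_iff.2 (hy j))
      ha hb hab
    rw [mem_ball_zero_iff, norm_eq_abs] at this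
    convert this using 2
    simp only [Complex.add_im, Complex.smul_im, smul_eq_mul]
    linear_combination -(t j).im * hab
  have hUr : ∀ x : ℝ, (x : ℂ) ∈ U := fun x j => by simpa using ht j
  exact eqOn_of_eq_ofReal hUo hUc hUr (f := fun c => tubeF lam n u fun j => t j + c)
    (g := fun c => Complex.exp (Complex.I * c * (∑ j, u j : ℝ)) * tubeF lam n u t)
    ((differentiableOn_tubeF hlam hB0 hB u).comp (t := tube (n + 2))
      (f := fun c : ℂ => fun j => t j + c)
      (fun c _ => DifferentiableAt.differentiableWithinAt (by fun_prop)) fun c hc => hc)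
    (fun c _ => DifferentiableAt.differentiableWithinAt (by fun_prop))
    (tubeF_add_ofReal_of_realF_add (realF_add_const lam n) u t) htc

/-! ### The continuation to `domainA` -/

/-- The function `F_{n+2}` in the tube with axis `φ`. -/
def shiftedF (lam : ℂ) (n : ℕ) (u : Fin (n + 2) → ℝ) (φ : ℝ) (t : Fin (n + 2) → ℂ) : ℂ :=
  Complex.exp (-(φ * (∑ j, u j : ℝ))) * tubeF lam n u fun j => t j + -(φ * Complex.I)

theorem shiftedF_eq {lam : ℂ} (hlam : 1 ≤ lam.re) {n : ℕ} {B : ℝ} (hB0 : 0 ≤ B)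
    (hB : RealBound lam n B) (u : Fin (n + 2) → ℝ) {t : Fin (n + 2) → ℂ} {φ ψ : ℝ}
    (hφ : (fun j => t j + -(φ * Complex.I)) ∈ tube (n + 2))
    (hψ : (fun j => t j + -(ψ * Complex.I)) ∈ tube (n + 2)) :
    shiftedF lam n u φ t = shiftedF lam n u ψ t := by
  have h : (fun j => (t j + -(ψ * Complex.I)) + (ψ - φ) * Complex.I) =
      fun j => t j + -(φ * Complex.I) := by
    ext j
    ring
  have := tubeF_add_const hlam hB0 hB u hψ (c := (ψ - φ) * Complex.I) (by rwa [h])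
  rw [h] at this
  rw [shiftedF, this, shiftedF, ← mul_assoc, ← Complex.exp_add]
  congr 2
  linear_combination (-φ + ψ) * (∑ j, u j : ℝ) * Complex.I_sq

theorem exists_isImOrdering {n : ℕ} (t : Fin (n + 1) → ℂ) : ∃ j, IsImOrdering t j :=
  exists_perm_antitone fun k => (t k).im

theorem dist_lt_pi {n : ℕ} {t : Fin (n + 1) → ℂ} (ht : t ∈ domainA n)
    (j : Equiv.Perm (Fin (n + 1))) : dist t j < π := by
  unfold dist
  rcases lt_trichotomy (j 0) (j (Fin.last n)) with h | h | h
  · exact (le_abs_self _).trans_lt (ht _ _ h)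
  · rw [h, sub_self]
    exact pi_pos
  · refine (le_abs_self _).trans_lt ?_
    rw [← neg_sub, Complex.neg_im, abs_neg]
    exact ht _ _ h

/-- `phi` is the midpoint between the largest and the smallest imaginary part. -/
theorem IsImOrdering.abs_im_sub_phi_le {n : ℕ} {t : Fin (n + 1) → ℂ}
    {j : Equiv.Perm (Fin (n + 1))} (hj : IsImOrdering t j) (k : Fin (n + 1)) :
    |(t k).im - phi t j| ≤ dist t j / 2 := by
  have h1 := hj (Fin.zero_le (j.symm k))
  have h2 := hj (Fin.le_last (j.symm k))
  simp only [Equiv.apply_symm_apply] at h1 h2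
  rw [abs_le]
  simp only [phi, dist, Complex.add_im, Complex.sub_im]
  constructor <;> linarith

theorem isOpen_domainA (n : ℕ) : IsOpen (domainA n) := by
  simp only [domainA, Set.ofPred_forall]
  exact isOpen_iInter_of_finite fun j => isOpen_iInter_of_finite fun k =>
    isOpen_iInter_of_finite fun _ => isOpen_lt (by fun_prop) continuous_const

theorem IsImOrdering.add_mem_tube {n : ℕ} {t : Fin (n + 1) → ℂ} {j : Equiv.Perm (Fin (n + 1))}
    (hj : IsImOrdering t j) (ht : t ∈ domainA n) :
    (fun k => t k + -(phi t j * Complex.I)) ∈ tube (n + 1) := fun k => by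
  have h1 := hj.abs_im_sub_phi_le k
  have h2 := dist_lt_pi ht j
  rw [sub_eq_add_neg] at h1
  simp only [Complex.add_im, Complex.neg_im, Complex.im_ofReal_mul, Complex.I_im, mul_one]
  linarith

theorem exists_isContinuation {lam : ℂ} (hlam : 1 ≤ lam.re) {n : ℕ} {B : ℝ} (hB0 : 0 ≤ B)
    (hB : RealBound lam n B) (u : Fin (n + 2) → ℝ) :
    ∃ G, IsContinuation lam (n + 1) u G ∧ ∀ t ∈ domainA (n + 1), ∀ j, IsImOrdering t j →
      G t = shiftedF lam n u (phi t j) t := by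
  choose o ho using fun t : Fin (n + 2) → ℂ => exists_isImOrdering t
  have hreal : ∀ x : Fin (n + 2) → ℝ, (fun j => (x j : ℂ)) ∈ domainA (n + 1) := fun x j k _ => by
    simpa using pi_pos
  have heq : ∀ t ∈ domainA (n + 1), ∀ φ : ℝ, (fun j => t j + -(φ * Complex.I)) ∈ tube (n + 2) →
      shiftedF lam n u (phi t (o t)) t = shiftedF lam n u φ t := fun t ht φ hφ =>
    shiftedF_eq hlam hB0 hB u ((ho t).add_mem_tube ht) hφ
  refine ⟨fun t => shiftedF lam n u (phi t (o t)) t, ⟨fun t ht => ?_, fun x => ?_⟩,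
    fun t ht j hj => heq t ht _ (hj.add_mem_tube ht)⟩
  -- The chosen ordering may jump with the point. Near `t` the axis is frozen at its value there,
  -- which stays admissible and gives the same function.
  · set φ := phi t (o t) with hφ
    set V : Set (Fin (n + 2) → ℂ) := {t | (fun j => t j + -(φ * Complex.I)) ∈ tube (n + 2)}
    have hVo : IsOpen V := (isOpen_tube (n + 2)).preimage
      (f := fun t : Fin (n + 2) → ℂ => fun j => t j + -(φ * Complex.I)) (by fun_prop)
    have htV : t ∈ V := (ho t).add_mem_tube ht
    have hd : DifferentiableOn ℂ (shiftedF lam n u φ) V := by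
      unfold shiftedF
      refine DifferentiableOn.const_mul ?_ _
      exact (differentiableOn_tubeF hlam hB0 hB u).comp (t := tube (n + 2))
        (f := fun t : Fin (n + 2) → ℂ => fun j => t j + -(φ * Complex.I))
        (fun c _ => DifferentiableAt.differentiableWithinAt (by fun_prop)) fun c hc => hc
    refine ((hd.differentiableAt (hVo.mem_nhds htV)).congr_of_eventuallyEq
      ?_).differentiableWithinAt
    filter_upwards [hVo.mem_nhds htV, (isOpen_domainA (n + 1)).mem_nhds ht] with y hyV hyA
    exact heq y hyA φ hyV
  · have h0 : (fun j => (x j : ℂ) + -(((0 : ℝ) : ℂ) * Complex.I)) ∈ tube (n + 2) := fun j => by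
      simpa using pi_pos
    have := heq _ (hreal x) 0 h0
    rw [← tubeF_ofReal]
    refine this.trans ?_
    simp [shiftedF]

/-- Reduction to one variable along the complex line `z ↦ Re t + z Im t`, which is real for real `z`
and equals `t` at `z = i`. Imaginary differences on it scale with `Im z`, so its preimage of
`domainA` is convex. -/
theorem IsContinuation.eqOn {lam : ℂ} {n : ℕ} {u : Fin (n + 1) → ℝ}
    {G H : (Fin (n + 1) → ℂ) → ℂ} (hG : IsContinuation lam n u G)
    (hH : IsContinuation lam n u H) : Set.EqOn G H (domainA n) := by
  intro t ht
  set line : ℂ → Fin (n + 1) → ℂ := fun z k => (t k).re + z * (t k).im with hline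
  have hlc : Differentiable ℂ line := by fun_prop
  set U : Set ℂ := {z | line z ∈ domainA n} with hU
  have him : ∀ z j k, (line z j - line z k).im = z.im * ((t j).im - (t k).im) := fun z j k => by
    simp [hline]
    ring
  have hUo : IsOpen U := (isOpen_domainA n).preimage hlc.continuous
  have hUc : Convex ℝ U := by
    intro x hx y hy a b ha hb hab j k hjk
    have := (convex_ball (0 : ℝ) π) (mem_ball_zero_iff.2 (hx j k hjk))
      (mem_ball_zero_iff.2 (hy j k hjk)) ha hb hab
    rw [mem_ball_zero_iff, norm_eq_abs] at this
    convert this using 2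
    simp only [him, Complex.add_im, Complex.smul_im, smul_eq_mul]
    ring
  have hUr : ∀ x : ℝ, (x : ℂ) ∈ U := fun x j k _ => by
    rw [him]
    simpa using pi_pos
  have hI : line Complex.I = t := by
    ext k
    simp only [hline]
    rw [mul_comm Complex.I, Complex.re_add_im]
  have hval : ∀ x : ℝ, G (line x) = H (line x) := fun x => by
    have : line x = fun k => (((t k).re + x * (t k).im : ℝ) : ℂ) := by
      ext k
      simp [hline]
    rw [this, hG.2, hH.2]
  have key := eqOn_of_eq_ofReal hUo hUc hUr (f := fun z => G (line z)) (g := fun z => H (line z))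
    (hG.1.comp hlc.differentiableOn fun z hz => hz)
    (hH.1.comp hlc.differentiableOn fun z hz => hz) hval
    (show Complex.I ∈ U by
      change line Complex.I ∈ domainA n
      rwa [hI])
  simpa only [hI] using key

theorem isContinuation_F {lam : ℂ} {n : ℕ} {u : Fin (n + 1) → ℝ} {G : (Fin (n + 1) → ℂ) → ℂ}
    (hG : IsContinuation lam n u G) : IsContinuation lam n u fun t => F lam n t u := by
  have h : ∃ G, IsContinuation lam n u G := ⟨G, hG⟩
  have : (fun t => F lam n t u) = h.choose := by
    ext t
    rw [F, dif_pos h]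
  rw [this]
  exact h.choose_spec

/-! ### The explicit bound and the induction step -/

theorem sum_eq_add_add_sum_Ioo {n : ℕ} (f : Fin (n + 2) → ℝ) :
    ∑ k, f k = f 0 + f (Fin.last (n + 1)) + ∑ k ∈ Finset.Ioo 0 (Fin.last (n + 1)), f k := by
  have h : (Finset.univ : Finset (Fin (n + 2))) =
      insert 0 (insert (Fin.last (n + 1)) (Finset.Ioo 0 (Fin.last (n + 1)))) := by
    ext k
    simp only [Finset.mem_univ, Finset.mem_insert, Finset.mem_Ioo, true_iff]
    by_cases h0 : k = 0
    · exact Or.inl h0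
    by_cases h1 : k = Fin.last (n + 1)
    · exact Or.inr (Or.inl h1)
    exact Or.inr (Or.inr ⟨Fin.pos_iff_ne_zero.2 h0, Fin.lt_last_iff_ne_last.2 h1⟩)
  rw [h, Finset.sum_insert, Finset.sum_insert]
  · ring
  · simp
  · simp [Fin.ext_iff]

/-- The first and last terms cancel by the choice of `phi`; this is why only intermediate indices
appear in the exponent. -/
theorem sum_im_sub_phi {n : ℕ} (t : Fin (n + 2) → ℂ) (j : Equiv.Perm (Fin (n + 2))) :
    ∑ k, ((t k).im - phi t j) =
      ∑ k ∈ Finset.Ioo 0 (Fin.last (n + 1)), ((t (j k)).im - phi t j) := by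
  rw [← Equiv.sum_comp j, sum_eq_add_add_sum_Ioo]
  simp only [phi, Complex.add_im]
  ring

/-- The upper bound for `F_{n+1}`, without its constant. -/
def majorant (lam : ℂ) {n : ℕ} (u : Fin (n + 1) → ℝ) (t : Fin (n + 1) → ℂ)
    (j : Equiv.Perm (Fin (n + 1))) : ℝ :=
  exp (-(phi t j * ∑ k, u k +
      u (Fin.last n) * ∑ k ∈ Finset.Ioo 0 (Fin.last n), ((t (j k)).im - phi t j))) *
    ∏ k : Fin (n + 1), ∏ l ∈ Finset.Ioi k, sinhRatio lam.re (t k - t l).re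

theorem majorant_pos {lam : ℂ} (hlam : 1 ≤ lam.re) {n : ℕ} (u : Fin (n + 1) → ℝ)
    (t : Fin (n + 1) → ℂ) (j : Equiv.Perm (Fin (n + 1))) : 0 < majorant lam u t j :=
  mul_pos (exp_pos _) (Finset.prod_pos fun _ _ => Finset.prod_pos fun _ _ =>
    sinhRatio_pos (by linarith) _)

theorem majorant_ofReal (lam : ℂ) {n : ℕ} (u x : Fin (n + 1) → ℝ) :
    majorant lam u (fun j => (x j : ℂ)) (Equiv.refl _) =
      ∏ k : Fin (n + 1), ∏ l ∈ Finset.Ioi k, sinhRatio lam.re (x k - x l) := by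
  simp [majorant, phi]

/-- All claims about `F_{n+1}` at the parameter `lam`, with the constant `C lam`. -/
def Claim (n : ℕ) (C : ℂ → ℝ → ℝ) (lam : ℂ) (u : Fin (n + 1) → ℝ) : Prop :=
  (∀ x : Fin (n + 1) → ℝ, DefiningIntegralConverges lam n x u) ∧
    IsContinuation lam n u (fun t => F lam n t u) ∧
    ∀ t ∈ domainA n, ∀ j : Equiv.Perm (Fin (n + 1)), IsImOrdering t j →
      ‖F lam n t u‖ < C lam (dist t j) * majorant lam u t j

/-- With constant `1` the bound is an equality; `2` makes it strict. -/
theorem claim_zero (lam : ℂ) (u : Fin 1 → ℝ) : Claim 0 (fun _ _ => 2) lam u := by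
  have hG : IsContinuation lam 0 u
      fun t => Complex.exp (Complex.I * t 0 * (u 0 : ℂ)) :=
    ⟨fun t _ => DifferentiableAt.differentiableWithinAt (by fun_prop), fun x => rfl⟩
  refine ⟨fun x => trivial, isContinuation_F hG, fun t ht j hj => ?_⟩
  have hF := (isContinuation_F hG).eqOn hG ht
  simp only at hF
  have hj0 : ∀ k, j k = 0 := fun k => Fin.fin_one_eq_zero _
  rw [hF, Complex.norm_exp]
  have h1 : (Complex.I * t 0 * (u 0 : ℂ)).re = -((t 0).im * u 0) := by simp
  have h2 : majorant lam u t j = exp (-((t 0).im * u 0)) := by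
    simp [majorant, phi, hj0]
  rw [h1, h2]
  linarith [exp_pos (-((t 0).im * u 0))]

/-- At real points `phi` and `dist` vanish and every ordering is admissible, so only `C lam 0`
enters the next step. -/
theorem realBound_of_claim {n : ℕ} {C : ℂ → ℝ → ℝ} {lam : ℂ} (hlam : 1 ≤ lam.re)
    (h : ∀ u, Claim n C lam u) : 0 ≤ C lam 0 ∧ RealBound lam n (C lam 0) := by
  have hreal : ∀ x : Fin (n + 1) → ℝ, (fun j => (x j : ℂ)) ∈ domainA n := fun x j k _ => by
    simpa using pi_pos
  have hbd : ∀ u x : Fin (n + 1) → ℝ, ‖realF lam n x u‖ < C lam 0 *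
      ∏ k : Fin (n + 1), ∏ l ∈ Finset.Ioi k, sinhRatio lam.re (x k - x l) := fun u x => by
    have := (h u).2.2 _ (hreal x) (Equiv.refl _) (fun a b _ => by simp)
    have hx : F lam n (fun j => (x j : ℂ)) u = realF lam n x u := (h u).2.1.2 x
    rw [majorant_ofReal, hx] at this
    simpa [dist] using this
  refine ⟨?_, fun u => ⟨?_, fun s => (hbd u s).le⟩⟩
  · refine (pos_of_mul_pos_left ((norm_nonneg _).trans_lt (hbd 0 0)) ?_).le
    exact Finset.prod_nonneg fun _ _ => Finset.prod_nonneg fun _ _ =>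
      (sinhRatio_pos (by linarith) _).le
  · have hc := (h u).2.1.1.continuousOn
    have := hc.comp_continuous (f := fun x : Fin (n + 1) → ℝ => fun j => (x j : ℂ))
      (by fun_prop) hreal
    exact this.congr fun x => (h u).2.1.2 x

theorem exists_claim_succ {n : ℕ} {C : ℂ → ℝ → ℝ}
    (hC : ContinuousOn (fun p : ℂ × ℝ => C p.1 p.2) ({lam : ℂ | 1 ≤ lam.re} ×ˢ Set.Ico (0 : ℝ) π))
    (h : ∀ u lam, 1 ≤ lam.re → Claim n C lam u) :
    ∃ C' : ℂ → ℝ → ℝ,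
      ContinuousOn (fun p : ℂ × ℝ => C' p.1 p.2) ({lam : ℂ | 1 ≤ lam.re} ×ˢ Set.Ico (0 : ℝ) π) ∧
      ∀ u lam, 1 ≤ lam.re → Claim (n + 1) C' lam u := by
  obtain ⟨c, P, hc, hle⟩ := exists_norm_tubeF_le n
  -- The angle `d / 2` bounds the imaginary parts measured from the axis `phi`; the summand `1`
  -- makes the inequality strict.
  refine ⟨fun lam d => 1 + C lam 0 * coshConst lam (d / 2) ^ ((n + 2) * (n + 1)) *
    (c * (lam.re + 1) ^ P), ?_, fun u lam hlam => ?_⟩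
  · have h1 : ContinuousOn (fun p : ℂ × ℝ => C p.1 0)
        ({lam : ℂ | 1 ≤ lam.re} ×ˢ Set.Ico (0 : ℝ) π) :=
      hC.comp (f := fun p : ℂ × ℝ => (p.1, (0 : ℝ))) (by fun_prop)
        fun p hp => ⟨hp.1, le_rfl, pi_pos⟩
    have h2 : ContinuousOn (fun p : ℂ × ℝ => coshConst p.1 (p.2 / 2))
        ({lam : ℂ | 1 ≤ lam.re} ×ˢ Set.Ico (0 : ℝ) π) := by
      unfold coshConst
      have hre : Continuous fun p : ℂ × ℝ => p.1.re := Complex.continuous_re.comp continuous_fst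
      have him : Continuous fun p : ℂ × ℝ => p.1.im := Complex.continuous_im.comp continuous_fst
      refine ContinuousOn.mul (ContinuousOn.rpow (by fun_prop) hre.neg.continuousOn
        fun p hp => Or.inl ?_) (by fun_prop)
      have := hp.2.1
      have := hp.2.2
      exact (cos_pos_of_mem_Ioo ⟨by linarith [pi_pos], by linarith⟩).ne'
    have h3 : ContinuousOn (fun p : ℂ × ℝ => c * (p.1.re + 1) ^ P)
        ({lam : ℂ | 1 ≤ lam.re} ×ˢ Set.Ico (0 : ℝ) π) := by
      have hre : Continuous fun p : ℂ × ℝ => p.1.re := Complex.continuous_re.comp continuous_fst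
      fun_prop
    exact continuousOn_const.add ((h1.mul (h2.pow _)).mul h3)
  obtain ⟨hB0, hB⟩ := realBound_of_claim hlam fun u => h u lam hlam
  obtain ⟨G, hG, hGeq⟩ := exists_isContinuation hlam hB0 hB u
  refine ⟨fun x => ?_, isContinuation_F hG, fun t ht j hj => ?_⟩
  · have := integrable_integrand hlam hB0 hB u (θ := 0) (t := fun j => (x j : ℂ))
      (by linarith [pi_pos]) (by simp)
    refine this.congr (ae_of_all _ fun s => ?_)
    simp only [integrand, complexKernel_ofReal]
  · have hd := dist_lt_pi ht j
    have hF : F lam (n + 1) t u = G t := (isContinuation_F hG).eqOn hG ht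
    rw [hF, hGeq t ht j hj, shiftedF, norm_mul]
    have him : ∀ k, (t k + -(phi t j * Complex.I)).im = (t k).im - phi t j := fun k => by
      simp [sub_eq_add_neg]
    have hT := hle lam hlam (C lam 0) hB0 hB u (dist t j / 2) (by linarith)
      (fun k => t k + -(phi t j * Complex.I))
      (fun k => by rw [him]; exact hj.abs_im_sub_phi_le k)
    simp only [him, add_sub_add_right_eq_sub, sum_im_sub_phi] at hT
    have hE : ‖Complex.exp (-(phi t j * (∑ j, u j : ℝ)))‖ = exp (-(phi t j * ∑ j, u j)) := by
      rw [← Complex.ofReal_mul, ← Complex.ofReal_neg, Complex.norm_exp, Complex.ofReal_re]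
    rw [hE]
    refine (mul_le_mul_of_nonneg_left hT (exp_pos _).le).trans_lt ?_
    beta_reduce
    rw [one_add_mul]
    refine lt_add_of_pos_of_le (majorant_pos hlam u t j) (le_of_eq ?_)
    rw [majorant, neg_add, exp_add]
    ring

end

end CalogeroMoser

theorem theorem6p3 (n : ℕ) :
    ∃ C : ℂ → ℝ → ℝ,
      ContinuousOn (fun p : ℂ × ℝ => C p.1 p.2)
        ({lam : ℂ | 1 ≤ lam.re} ×ˢ Set.Ico (0 : ℝ) Real.pi) ∧
      ∀ (u : Fin (n + 1) → ℝ) (lam : ℂ), 1 ≤ lam.re →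
        (∀ x : Fin (n + 1) → ℝ, CalogeroMoser.DefiningIntegralConverges lam n x u) ∧
        CalogeroMoser.IsContinuation lam n u (fun t => CalogeroMoser.F lam n t u) ∧
        ∀ t ∈ CalogeroMoser.domainA n, ∀ j : Equiv.Perm (Fin (n + 1)),
          CalogeroMoser.IsImOrdering t j →
          ‖CalogeroMoser.F lam n t u‖ <
            C lam (CalogeroMoser.dist t j) *
              Real.exp (-(CalogeroMoser.phi t j * ∑ k, u k +
                u (Fin.last n) *
                  ∑ k ∈ Finset.Ioo 0 (Fin.last n),
                    ((t (j k)).im - CalogeroMoser.phi t j))) *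
              ∏ k : Fin (n + 1), ∏ l ∈ Finset.Ioi k,
                CalogeroMoser.sinhRatio lam.re (t k - t l).re := by
  have key : ∃ C : ℂ → ℝ → ℝ,
      ContinuousOn (fun p : ℂ × ℝ => C p.1 p.2)
        ({lam : ℂ | 1 ≤ lam.re} ×ˢ Set.Ico (0 : ℝ) Real.pi) ∧
      ∀ u lam, 1 ≤ lam.re → CalogeroMoser.Claim n C lam u := by
    induction n with
    | zero => exact ⟨fun _ _ => 2, continuousOn_const, fun u lam _ => CalogeroMoser.claim_zero lam u⟩
    | succ n ih =>
      obtain ⟨C, hC, h⟩ := ih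
      exact CalogeroMoser.exists_claim_succ hC h
  obtain ⟨C, hC, h⟩ := key
  refine ⟨C, hC, fun u lam hlam => ⟨(h u lam hlam).1, (h u lam hlam).2.1, fun t ht j hj => ?_⟩⟩
  rw [mul_assoc]
  exact (h u lam hlam).2.2 t ht j hj
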